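/- **Setting.** Let $(\Omega,P)$ be a probability space carrying covariates $W$, features $X=\phi(W)$ (a measurable function of $W$, e.g. a sub-vector), a binary treatment $D\in\{0,1\}$, integrable potential outcomes $Y(1),Y(0)$ and the observed outcome $Y=D\,Y(1)+(1-D)\,Y(0)$. Assume conditional exogeneity $(Y(1),Y(0))\perp D\mid W$ and overlap $0<p_0(W)<1$ almost surely, where $p_0(W)=\mathbb E[D\mid W]$. Put $$\tau_0(X)=\mathbb E[Y(1)-Y(0)\mid X],\qquad h_0(D,W)=\mathbb E[Y\mid D,W],\qquad a_0(D,W)=\frac{D-p_0(W)}{p_0(W)(1-p_0(W))},$$ and assume $\tau_0(X)\in L^2$. For a function $f$ of $X$ write $\|f-\tau_0\|^2=\mathbb E[(f(X)-\tau_0(X))^2]$. Let $n,M\ge 1$ and let $Z_1,\dots,Z_n$ be i.i.d. copies of $(W,D,Y)$. Let the candidate models $f_1,\dots,f_M$ (functions of $X$) and the nuisance estimates $\hat g=(\hat h,\hat a)$ (functions of $(D,W)$) be fixed or computed from training data independent of $(Z_1,\dots,Z_n)$; below, expectations under $P$ and conditional expectations given $X$ are taken with this training data held fixed. Define the doubly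 robust label $$\hat Y(\hat g)=\hat h(1,W)-\hat h(0,W)+\hat a(D,W)\,(Y-\hat h(D,W)),$$ $\hat q(D,W)=(a_0(D,W)-\hat a(D,W))\,(h_0(D,W)-\hat h(D,W))$, assumed integrable, and $$\mathrm{Error}(\hat g)=2\sqrt{\mathbb E\big[\mathbb E[\hat q(D,W)\mid X]^2\big]}.$$ Assume $|\hat Y(\hat g)|\le U$ and $|f_j(X)|\le U$ for all $j$, almost surely. For $\theta$ in the simplex $\Theta=\{\theta\in\mathbb R^M_{\ge0}:\sum_j\theta_j=1\}$ let $f_\theta=\sum_j\theta_jf_j$. Given strictly positive prior weights $\pi_1,\dots,\pi_M$ with $\sum_j\pi_j=1$ and $\beta\in\mathbb R$, the doubly robust Q-aggregation ensemble with $\nu=1/2$ is any minimizer $\hat\theta$ over $\Theta$ of $$\frac1n\sum_{i=1}^n\Big[\tfrac12(\hat Y_i(\hat g)-f_\theta(X_i))^2+\tfrac12\sum_{j}\theta_j(\hat Y_i(\hat g)-f_j(X_i))^2\Big]+\frac\beta n\sum_j\theta_j\log(1/\pi_j),$$ where $\hat Y_i(\hat g)$ and $X_i$ are $\hat Y(\hat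 g)$ and $X$ evaluated at the observation $Z_i$. **Claim.** For every $U\ge0$ there is a constant $C>0$ depending only on $U$ such that, in every such setting and for every $\delta\in(0,1)$: 1. (Uniform prior.) If $\pi_j=1/M$ for all $j$ (and $\beta$ is arbitrary; it does not affect $\hat\theta$), then with probability at least $1-\delta$ $$\|f_{\hat\theta}-\tau_0\|^2\le\min_j\|f_j-\tau_0\|^2+C\Big(\frac{\log(M/\delta)}n+\mathrm{Error}(\hat g)^2\Big).$$ 2. (General prior.) For any prior $\pi$ as above and any $\beta\ge\max\{112\,U^2,\,56\,U^3\}$, with probability at least $1-\delta$ $$\|f_{\hat\theta}-\tau_0\|^2\le\min_j\Big(\|f_j-\tau_0\|^2+\frac\beta n\log(1/\pi_j)\Big)+C\Big(\frac{\log(1/\delta)}n+\mathrm{Error}(\hat g)^2\Big).$$ -/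

import Mathlib

open MeasureTheory ProbabilityTheory

namespace DRQAgg

noncomputable section

/-! ### The causal population model -/

section Population

variable {Ω β γ : Type*} [MeasurableSpace Ω] [MeasurableSpace β] [MeasurableSpace γ]

/-- `F` and `G` are conditionally independent given the sub-sigma-algebra `m`:
`ℙ(F ∈ s, G ∈ t | m) = ℙ(F ∈ s | m) ℙ(G ∈ t | m)` almost surely, for all measurable `s, t`.
This needs no regularity of the probability space. -/
def CondIndepGiven (P : Measure Ω) (m : MeasurableSpace Ω) (F : Ω → β) (G : Ω → γ) : Prop :=
  ∀ (s : Set β) (t : Set γ), MeasurableSet s → MeasurableSet t →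
    P[(F ⁻¹' s ∩ G ⁻¹' t).indicator (fun _ => (1 : ℝ)) | m] =ᵐ[P]
      fun ω => (P[(F ⁻¹' s).indicator (fun _ => (1 : ℝ)) | m]) ω *
        (P[(G ⁻¹' t).indicator (fun _ => (1 : ℝ)) | m]) ω

/-- On a standard Borel space this is Mathlib's conditional independence. -/
theorem condIndepGiven_iff {Ω β γ : Type*} {m mΩ : MeasurableSpace Ω} [StandardBorelSpace Ω]
    [MeasurableSpace β] [MeasurableSpace γ] (P : Measure Ω) [IsFiniteMeasure P]
    (hm : m ≤ mΩ) (F : Ω → β) (G : Ω → γ) (hF : Measurable F) (hG : Measurable G) :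
    CondIndepGiven P m F G ↔ CondIndepFun m hm F G P :=
  (condIndepFun_iff_condExp_inter_preimage_eq_mul hF hG).symm

/-- The sigma-algebra generated by a random element `V`. -/
abbrev sigmaOf {Ω β : Type*} [mβ : MeasurableSpace β] (V : Ω → β) : MeasurableSpace Ω :=
  MeasurableSpace.comap V mβ

/-- The conditional average treatment effect `τ₀(X) = 𝔼[Y(1) - Y(0) | X]`. -/
def cate (P : Measure Ω) (X : Ω → β) (Y₁ Y₀ : Ω → ℝ) : Ω → ℝ :=
  P[fun ω => Y₁ ω - Y₀ ω | sigmaOf X]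

/-- The propensity `p₀(W) = 𝔼[D | W]`. -/
def propensity (P : Measure Ω) (W : Ω → β) (D : Ω → ℝ) : Ω → ℝ :=
  P[D | sigmaOf W]

/-- The outcome regression `h₀(D, W) = 𝔼[Y | D, W]`. -/
def outcomeReg (P : Measure Ω) (W : Ω → β) (D Y : Ω → ℝ) : Ω → ℝ :=
  P[Y | sigmaOf (fun ω => (D ω, W ω))]

/-- The signed inverse propensity
`a₀(D, W) = (D - p₀(W)) / (p₀(W) (1 - p₀(W)))`. -/
def signedInvPropensity (P : Measure Ω) (W : Ω → β) (D : Ω → ℝ) : Ω → ℝ := fun ω =>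
  (D ω - propensity P W D ω) / (propensity P W D ω * (1 - propensity P W D ω))

/-- The product of nuisance errors
`q(D, W) = (a₀(D, W) - a(D, W)) (h₀(D, W) - h(D, W))` of the nuisance pair `(h, a)`. -/
def nuisanceProduct (P : Measure Ω) (W : Ω → β) (D Y : Ω → ℝ) (h a : ℝ → β → ℝ) : Ω → ℝ :=
  fun ω => (signedInvPropensity P W D ω - a (D ω) (W ω)) *
    (outcomeReg P W D Y ω - h (D ω) (W ω))

/-- `Error(g) = 2 √(𝔼[𝔼[q(D, W) | X]²])` for the nuisance pair `g = (h, a)`. -/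
def nuisanceError (P : Measure Ω) (X : Ω → γ) (W : Ω → β) (D Y : Ω → ℝ)
    (h a : ℝ → β → ℝ) : ℝ :=
  2 * Real.sqrt (∫ ω, ((P[nuisanceProduct P W D Y h a | sigmaOf X]) ω) ^ 2 ∂P)

/-- The squared distance `‖f - τ‖² = 𝔼[(f(X) - τ)²]`. -/
def sqDist (P : Measure Ω) (X : Ω → γ) (f : γ → ℝ) (τ : Ω → ℝ) : ℝ :=
  ∫ ω, (f (X ω) - τ ω) ^ 2 ∂P

end Population

/-! ### Doubly robust Q-aggregation -/

section Aggregation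

variable {𝒲 𝒳 : Type*} {M n : ℕ}

/-- The doubly robust label `h(1, w) - h(0, w) + a(d, w) (y - h(d, w))` of the observation
`z = (w, d, y)`. -/
def drLabel (h a : ℝ → 𝒲 → ℝ) (z : 𝒲 × ℝ × ℝ) : ℝ :=
  h 1 z.1 - h 0 z.1 + a z.2.1 z.1 * (z.2.2 - h z.2.1 z.1)

/-- The doubly robust square loss of the model `f` at `z = (w, d, y)`, with features
`x = proj w`. -/
def drLoss (proj : 𝒲 → 𝒳) (h a : ℝ → 𝒲 → ℝ) (f : 𝒳 → ℝ) (z : 𝒲 × ℝ × ℝ) : ℝ :=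
  (drLabel h a z - f (proj z.1)) ^ 2

/-- The ensemble `f_θ = ∑ⱼ θⱼ fⱼ`. -/
def ensemble (f : Fin M → 𝒳 → ℝ) (θ : Fin M → ℝ) : 𝒳 → ℝ :=
  fun x => ∑ j, θ j * f j x

/-- The modified loss `(1 - ν) ℓ(z; f_θ) + ν ∑ⱼ θⱼ ℓ(z; fⱼ)`. -/
def modifiedLoss (ν : ℝ) (proj : 𝒲 → 𝒳) (h a : ℝ → 𝒲 → ℝ) (f : Fin M → 𝒳 → ℝ)
    (θ : Fin M → ℝ) (z : 𝒲 × ℝ × ℝ) : ℝ :=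
  (1 - ν) * drLoss proj h a (ensemble f θ) z + ν * ∑ j, θ j * drLoss proj h a (f j) z

/-- The Q-aggregation objective: the empirical mean of the modified loss over the sample `z`,
plus `(β / n) ∑ⱼ θⱼ log (1 / πⱼ)`, where `π = prior`. -/
def qObjective (ν β : ℝ) (prior : Fin M → ℝ) (proj : 𝒲 → 𝒳) (h a : ℝ → 𝒲 → ℝ)
    (f : Fin M → 𝒳 → ℝ) (z : Fin n → 𝒲 × ℝ × ℝ) (θ : Fin M → ℝ) : ℝ :=
  (1 / (n : ℝ)) * ∑ i, modifiedLoss ν proj h a f θ (z i) +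
    β / (n : ℝ) * ∑ j, θ j * Real.log (1 / prior j)

/-- `θ` is a Q-aggregation weight vector: it minimizes the objective over the simplex. -/
def IsQAggregate (ν β : ℝ) (prior : Fin M → ℝ) (proj : 𝒲 → 𝒳) (h a : ℝ → 𝒲 → ℝ)
    (f : Fin M → 𝒳 → ℝ) (z : Fin n → 𝒲 × ℝ × ℝ) (θ : Fin M → ℝ) : Prop :=
  θ ∈ stdSimplex ℝ (Fin M) ∧
    ∀ θ' ∈ stdSimplex ℝ (Fin M),
      qObjective ν β prior proj h a f z θ ≤ qObjective ν β prior proj h a f z θ'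

end Aggregation

end

end DRQAgg

namespace DRQAgg

/-! ### An exponential deviation inequality for finite families -/

/-! Fix the training data and let `J` be the oracle index, `r = f_J`, `y` the label. Three
ingredients combine.

Optimality. Along the segment from a minimizer `θ` to the vertex `J` the modified loss is quadratic,
with curvature given by `(f_θ - r)²`. Minimality therefore yields an empirical excess inequality
with a spare `½ (f_θ - r)²`. The resulting left side is an average of `pairExcess` over two models
drawn independently from `θ` (`sum_sum_mul_pairExcess`, `IsQAggregate.sum_pairExcess_le`). Being
linear in `θ ⊗ θ`, it can be controlled for all `θ` at once by a union bound over the finitely many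
pairs.

Concentration. `pairExcess` vanishes to first order at `u = v = r`, so its second moment is at most
`18 U²` times the squared distances of the two models to `r`. A Bernstein-type bound with weight
`π_j π_k` on the pair `(j, k)` (`measure_exists_deviation_le`) costs `56 U² (log (1/π_j) + log
(1/π_k) + log (1/δ)) / n` plus a multiple of these distances. The logarithms of the prior are
absorbed by the penalty, and the distances by the quarter subtracted in
`sum_sum_mul_pairExcess_sub`. What is left over is a gain `(1/56) E (f_θ - r)²` in the risk for the
label (`excess_le_of_deviation`).

Causal bias. The label plus the nuisance product has conditional mean `τ₀` given `X`
(`condExp_drLabel`). Passing from label risk to distance from `τ₀` thus costs only the cross term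
`-2 E[(f_θ - r) E[q | X]]`. Young's inequality bounds it by the spare `(1/56) E (f_θ - r)²` plus `56
E[E[q | X]²] = 14 Error²`. Spending the gain this way makes the nuisance error enter squared and
without loss in the oracle term. -/

theorem exp_le_one_add_add_sq {x : ℝ} (hx : |x| ≤ 1) : Real.exp x ≤ 1 + x + 3 / 4 * x ^ 2 := by
  -- The order-two remainder is `|x|² · 3 / (2! · 2)`, which is where `3/4` originates.
  have h := (abs_le.1 (Real.exp_bound hx (n := 2) (by norm_num))).2
  norm_num [Finset.sum_range_succ] at h
  linarith

section Deviation

variable {𝒵 𝒯 κ Ω' : Type*} [MeasurableSpace 𝒵] [MeasurableSpace 𝒯] [Fintype κ]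
  [MeasurableSpace Ω']

theorem integrable_of_abs_le {μ : Measure 𝒵} [IsFiniteMeasure μ] {G : 𝒵 → ℝ}
    (hG : AEStronglyMeasurable G μ) {B : ℝ} (hB : ∀ᵐ z ∂μ, |G z| ≤ B) : Integrable G μ :=
  Integrable.of_bound hG B hB

theorem integrable_sq_of_abs_le {μ : Measure 𝒵} [IsFiniteMeasure μ] {G : 𝒵 → ℝ}
    (hG : AEStronglyMeasurable G μ) {B : ℝ} (hB : ∀ᵐ z ∂μ, |G z| ≤ B) :
    Integrable (fun z => G z ^ 2) μ := by
  refine Integrable.of_bound (hG.pow 2) (B ^ 2) ?_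
  filter_upwards [hB] with z hz
  rw [Real.norm_eq_abs, abs_pow]
  exact pow_le_pow_left₀ (abs_nonneg _) hz 2

/-- The logarithm of the exponential weight of a deviation of `G` at one observation. -/
noncomputable def deviationExponent (μ : Measure 𝒵) (c : ℝ) (G : 𝒵 → ℝ) (z : 𝒵) : ℝ :=
  c * ((∫ y, G y ∂μ) - G z) - 3 / 4 * c ^ 2 * ∫ y, G y ^ 2 ∂μ

theorem integrable_exp_deviationExponent (μ : Measure 𝒵) [IsProbabilityMeasure μ]
    {G : 𝒵 → ℝ} (hG : AEStronglyMeasurable G μ) {B c : ℝ} (hB : ∀ᵐ z ∂μ, |G z| ≤ B)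
    (hc : 0 ≤ c) : Integrable (fun z => Real.exp (deviationExponent μ c G z)) μ := by
  refine Integrable.of_bound
    (C := Real.exp (c * ((∫ y, G y ∂μ) + B) - 3 / 4 * c ^ 2 * ∫ y, G y ^ 2 ∂μ)) ?_ ?_
  · exact Real.continuous_exp.comp_aestronglyMeasurable
      (((aestronglyMeasurable_const.sub hG).const_mul c).sub aestronglyMeasurable_const)
  · filter_upwards [hB] with z hz
    rw [Real.norm_eq_abs, Real.abs_exp, Real.exp_le_exp]
    have := mul_le_mul_of_nonneg_left (neg_le_of_abs_le hz) hc
    simp only [deviationExponent]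
    linarith

/-- On `c |G| ≤ 1` the exponential is bounded by a quadratic, whose mean involves only the first two
moments of `G`; then `1 + t ≤ exp t` shows that the compensator in the exponent cancels it. The
second moment takes the role of the variance. -/
theorem integral_exp_deviationExponent_le (μ : Measure 𝒵) [IsProbabilityMeasure μ]
    {G : 𝒵 → ℝ} (hG : AEStronglyMeasurable G μ) {B c : ℝ} (hB : ∀ᵐ z ∂μ, |G z| ≤ B)
    (hc : 0 ≤ c) (hcB : c * B ≤ 1) :
    ∫ z, Real.exp (deviationExponent μ c G z) ∂μ ≤ 1 := by
  have hi := integrable_of_abs_le hG hB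
  have hi2 := integrable_sq_of_abs_le hG hB
  set m := ∫ y, G y ∂μ
  set s := ∫ y, G y ^ 2 ∂μ
  have h1 : ∀ᵐ z ∂μ, Real.exp (deviationExponent μ c G z) ≤
      Real.exp (c * m - 3 / 4 * c ^ 2 * s) * (1 - c * G z + 3 / 4 * c ^ 2 * G z ^ 2) := by
    filter_upwards [hB] with z hz
    have hle : |(-(c * G z))| ≤ 1 := by
      rw [abs_neg, abs_mul, abs_of_nonneg hc]
      exact (mul_le_mul_of_nonneg_left hz hc).trans hcB
    have := exp_le_one_add_add_sq hle
    rw [show deviationExponent μ c G z = (c * m - 3 / 4 * c ^ 2 * s) + -(c * G z) by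
      simp only [deviationExponent, m, s]; ring, Real.exp_add]
    refine mul_le_mul_of_nonneg_left ?_ (Real.exp_pos _).le
    linarith
  have hi4 : Integrable (fun z => 1 - c * G z) μ := (integrable_const _).sub (hi.const_mul c)
  have hi3 : Integrable (fun z => 1 - c * G z + 3 / 4 * c ^ 2 * G z ^ 2) μ :=
    hi4.add (hi2.const_mul _)
  calc ∫ z, Real.exp (deviationExponent μ c G z) ∂μ
      ≤ ∫ z, Real.exp (c * m - 3 / 4 * c ^ 2 * s) *
          (1 - c * G z + 3 / 4 * c ^ 2 * G z ^ 2) ∂μ :=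
        integral_mono_ae (integrable_exp_deviationExponent μ hG hB hc) (hi3.const_mul _) h1
    _ = Real.exp (c * m - 3 / 4 * c ^ 2 * s) * (1 - c * m + 3 / 4 * c ^ 2 * s) := by
        rw [integral_const_mul, integral_add hi4 (hi2.const_mul _),
          integral_sub (integrable_const _) (hi.const_mul c),
          integral_const_mul, integral_const_mul]
        simp [m, s]
    _ ≤ Real.exp (c * m - 3 / 4 * c ^ 2 * s) * Real.exp (-(c * m - 3 / 4 * c ^ 2 * s)) := by
        refine mul_le_mul_of_nonneg_left ?_ (Real.exp_pos _).le
        have := Real.add_one_le_exp (-(c * m - 3 / 4 * c ^ 2 * s))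
        linarith
    _ = 1 := by rw [← Real.exp_add]; simp

/-- A weighted sum of exponential deviation weights of a finite family over a sample. -/
noncomputable def weightedDeviation {n : ℕ} (μ : Measure 𝒵) (c : ℝ) (w : κ → ℝ)
    (G : κ → 𝒵 → ℝ) (z : Fin n → 𝒵) : ℝ :=
  ∑ k, w k * ∏ i, Real.exp (deviationExponent μ c (G k) (z i))

/-- Independence factorizes each mean into one-observation factors at most `1`. Mixing with weights
of total mass at most `1` before applying Markov gives the union bound with cost `log (1 / w k)`. -/
theorem lintegral_weightedDeviation_le {n : ℕ} (μ : Measure 𝒵) [IsProbabilityMeasure μ]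
    {c B : ℝ} {w : κ → ℝ} {G : κ → 𝒵 → ℝ} (hG : ∀ k, AEStronglyMeasurable (G k) μ)
    (hB : ∀ k, ∀ᵐ z ∂μ, |G k z| ≤ B) (hc : 0 ≤ c) (hcB : c * B ≤ 1)
    (hw : ∀ k, 0 ≤ w k) (hw1 : ∑ k, w k ≤ 1) :
    ∫⁻ z, ENNReal.ofReal (weightedDeviation (n := n) μ c w G z) ∂(Measure.pi fun _ => μ) ≤ 1 := by
  have hint : ∀ k, Integrable (fun z : Fin n → 𝒵 =>
      w k * ∏ i, Real.exp (deviationExponent μ c (G k) (z i))) (Measure.pi fun _ => μ) := by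
    intro k
    refine Integrable.const_mul ?_ _
    exact Integrable.fintype_prod (f := fun _ z => Real.exp (deviationExponent μ c (G k) z))
      fun _ => integrable_exp_deviationExponent μ (hG k) (hB k) hc
  simp only [weightedDeviation]
  rw [← ofReal_integral_eq_lintegral_ofReal (integrable_finsetSum _ fun k _ => hint k)
    (Filter.Eventually.of_forall fun z => Finset.sum_nonneg fun k _ =>
      mul_nonneg (hw k) (Finset.prod_nonneg fun _ _ => (Real.exp_pos _).le)),
    ENNReal.ofReal_le_one, integral_finsetSum _ fun k _ => hint k]
  refine le_trans (Finset.sum_le_sum fun k _ => ?_) hw1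
  rw [integral_const_mul]
  refine mul_le_of_le_one_right (hw k) ?_
  rw [integral_fintype_prod_eq_prod (fun _ z => Real.exp (deviationExponent μ c (G k) z))]
  exact Finset.prod_le_one (fun _ _ => integral_nonneg fun _ => (Real.exp_pos _).le)
    fun _ _ => integral_exp_deviationExponent_le μ (hG k) (hB k) hc hcB

theorem measurable_weightedDeviation {n : ℕ} (μ : Measure 𝒵) [IsProbabilityMeasure μ]
    (c : ℝ) (w : κ → ℝ) {G : 𝒯 → κ → 𝒵 → ℝ}
    (hG : ∀ k, Measurable fun p : 𝒯 × 𝒵 => G p.1 k p.2) :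
    Measurable fun p : 𝒯 × (Fin n → 𝒵) => weightedDeviation μ c w (G p.1) p.2 := by
  have h1 : ∀ k, Measurable fun t => ∫ y, G t k y ∂μ := fun k =>
    ((hG k).stronglyMeasurable.integral_prod_right' (ν := μ)).measurable
  have h2 : ∀ k, Measurable fun t => ∫ y, G t k y ^ 2 ∂μ := fun k =>
    ((hG k).pow_const 2).stronglyMeasurable.integral_prod_right' (ν := μ) |>.measurable
  have h3 : ∀ k i, Measurable fun p : 𝒯 × (Fin n → 𝒵) => G p.1 k (p.2 i) := fun k i =>
    (hG k).comp (measurable_fst.prodMk ((measurable_pi_apply i).comp measurable_snd))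
  unfold weightedDeviation deviationExponent
  refine Finset.measurable_fun_sum _ fun k _ => Measurable.const_mul ?_ _
  refine Finset.measurable_fun_prod _ fun i _ => Real.measurable_exp.comp ?_
  exact (((h1 k).comp measurable_fst).sub (h3 k i)).const_mul c |>.sub
    (((h2 k).comp measurable_fst).const_mul _)

theorem measure_le_of_lintegral_le_one {μ : Measure 𝒵} {Φ : 𝒵 → ENNReal} (hΦ : Measurable Φ)
    (hΦ1 : ∫⁻ z, Φ z ∂μ ≤ 1) {δ : ℝ} (hδ : 0 < δ) :
    μ {z | ENNReal.ofReal (1 / δ) ≤ Φ z} ≤ ENNReal.ofReal δ := by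
  have h := (mul_meas_ge_le_lintegral hΦ (ENNReal.ofReal (1 / δ))).trans hΦ1
  rw [one_div, ENNReal.ofReal_inv_of_pos hδ] at h ⊢
  have h0 : ENNReal.ofReal δ ≠ 0 := by simpa using hδ
  calc _ = ENNReal.ofReal δ * ((ENNReal.ofReal δ)⁻¹ *
        μ {z | (ENNReal.ofReal δ)⁻¹ ≤ Φ z}) := by
        rw [← mul_assoc, ENNReal.mul_inv_cancel h0 ENNReal.ofReal_ne_top, one_mul]
    _ ≤ ENNReal.ofReal δ * 1 := mul_le_mul_right h _
    _ = _ := mul_one _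

/-- For an i.i.d. sample `Z` and independent training data `T`, with probability at least `1 - δ`
the averages of the functions `G T k` fall below their means by at most a multiple of the second
moment plus a term of order `(log (1 / w k) + log (1 / δ)) / n`, for all `k` at once. -/
theorem measure_exists_deviation_le {n : ℕ} {P' : Measure Ω'} [IsProbabilityMeasure P']
    (μ : Measure 𝒵) [IsProbabilityMeasure μ] {Z : Fin n → Ω' → 𝒵} {T : Ω' → 𝒯}
    (hZ : iIndepFun Z P') (hZm : ∀ i, AEMeasurable (Z i) P') (hZμ : ∀ i, P'.map (Z i) = μ)
    (hT : Measurable T) (hTZ : IndepFun T (fun ω i => Z i ω) P')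
    {c B : ℝ} {w : κ → ℝ} {G : 𝒯 → κ → 𝒵 → ℝ}
    (hG : ∀ k, Measurable fun p : 𝒯 × 𝒵 => G p.1 k p.2)
    (hB : ∀ᵐ t ∂(P'.map T), ∀ k, ∀ᵐ z ∂μ, |G t k z| ≤ B) (hc : 0 ≤ c) (hcB : c * B ≤ 1)
    (hw : ∀ k, 0 < w k) (hw1 : ∑ k, w k ≤ 1) {δ : ℝ} (hδ : 0 < δ) :
    P' {ω | ¬ ∀ k, ∑ i, c * ((∫ y, G (T ω) k y ∂μ) - G (T ω) k (Z i ω)) ≤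
      n * (3 / 4 * c ^ 2 * ∫ y, G (T ω) k y ^ 2 ∂μ) + Real.log (1 / w k) + Real.log (1 / δ)} ≤
      ENNReal.ofReal δ := by
  have hZm' : AEMeasurable (fun ω i => Z i ω) P' := aemeasurable_pi_iff.2 hZm
  have hmap : P'.map (fun ω => (T ω, fun i => Z i ω)) =
      (P'.map T).prod (Measure.pi fun _ => μ) := by
    rw [(indepFun_iff_map_prod_eq_prod_map_map hT.aemeasurable hZm').1 hTZ,
      (iIndepFun_iff_map_fun_eq_pi_map hZm).1 hZ]
    simp only [hZμ]
  have : IsProbabilityMeasure (P'.map T) := Measure.isProbabilityMeasure_map hT.aemeasurable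
  have hΦm := (measurable_weightedDeviation (n := n) μ c w hG).ennreal_ofReal
  have hΦ1 : ∫⁻ p : 𝒯 × (Fin n → 𝒵),
      ENNReal.ofReal (weightedDeviation μ c w (G p.1) p.2) ∂((P'.map T).prod (Measure.pi fun _ => μ)) ≤ 1 := by
    -- Since the training data are independent of the sample, the bound for fixed training data
    -- integrates to a bound for random data.
    rw [lintegral_prod _ hΦm.aemeasurable]
    calc _ ≤ ∫⁻ _, 1 ∂(P'.map T) := by
          refine lintegral_mono_ae ?_
          filter_upwards [hB] with t ht
          exact lintegral_weightedDeviation_le μ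
            (fun k => ((hG k).comp measurable_prodMk_left).aestronglyMeasurable) ht hc hcB
            (fun k => (hw k).le) hw1
      _ = 1 := by simp
  have hbound := measure_le_of_lintegral_le_one hΦm hΦ1 hδ
  rw [← hmap] at hbound
  refine le_trans (le_trans (measure_mono ?_)
    (Measure.le_map_apply (hT.aemeasurable.prodMk hZm') _)) hbound
  intro ω hω
  simp only [Set.mem_ofPred_eq, not_forall, not_le] at hω
  obtain ⟨k, hk⟩ := hω
  simp only [Set.mem_preimage, Set.mem_ofPred_eq]
  refine ENNReal.ofReal_le_ofReal ?_
  -- If the bound fails at one `k`, that single term already reaches the Markov threshold; the other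
  -- terms are nonnegative.
  have hterm : 1 / δ ≤ w k * ∏ i, Real.exp (deviationExponent μ c (G (T ω) k) (Z i ω)) := by
    rw [← Real.exp_sum]
    have hs : ∑ i, deviationExponent μ c (G (T ω) k) (Z i ω) =
        ∑ i, c * ((∫ y, G (T ω) k y ∂μ) - G (T ω) k (Z i ω)) -
          n * (3 / 4 * c ^ 2 * ∫ y, G (T ω) k y ^ 2 ∂μ) := by
      simp [deviationExponent, Finset.sum_sub_distrib]
    rw [hs]
    have hlog : Real.log (1 / w k) + Real.log (1 / δ) ≤
        ∑ i, c * ((∫ y, G (T ω) k y ∂μ) - G (T ω) k (Z i ω)) -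
          n * (3 / 4 * c ^ 2 * ∫ y, G (T ω) k y ^ 2 ∂μ) := by linarith
    have h := mul_le_mul_of_nonneg_left (Real.exp_le_exp.2 hlog) (hw k).le
    rw [Real.exp_add, Real.exp_log (one_div_pos.2 (hw k)), Real.exp_log (one_div_pos.2 hδ),
      ← mul_assoc, mul_one_div_cancel (hw k).ne', one_mul] at h
    exact h
  refine hterm.trans ?_
  exact Finset.single_le_sum (f := fun k => w k *
    ∏ i, Real.exp (deviationExponent μ c (G (T ω) k) (Z i ω)))
    (fun k _ => mul_nonneg (hw k).le (Finset.prod_nonneg fun _ _ => (Real.exp_pos _).le))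
    (Finset.mem_univ k)

end Deviation

/-! ### Strong convexity of the aggregation objective -/

section Algebra

variable {ι : Type*} [Fintype ι]

/-- The excess of a pair of predictions `u, v` over the reference prediction `r` at the label `y`;
averaged over independent pairs of models it controls the excess of the ensemble. -/
noncomputable def pairExcess (y r u v : ℝ) : ℝ :=
  1 / 2 * ((y - u) ^ 2 - (y - r) ^ 2) + 1 / 2 * ((y - v) ^ 2 - (y - r) ^ 2) -
    1 / 4 * ((u - r) ^ 2 + (v - r) ^ 2) + (u - r) * (v - r)

theorem sum_sum_mul_add_add_mul {θ : ι → ℝ} (hθ : ∑ j, θ j = 1) (α b : ι → ℝ) :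
    ∑ j, ∑ k, θ j * θ k * (α j + α k + b j * b k) =
      2 * ∑ j, θ j * α j + (∑ j, θ j * b j) ^ 2 := by
  have h1 : ∑ j, ∑ k, θ j * θ k * α j = ∑ j, θ j * α j := by
    refine Finset.sum_congr rfl fun j _ => ?_
    rw [← Finset.sum_mul, ← Finset.mul_sum, hθ, mul_one]
  have h2 : ∑ j, ∑ k, θ j * θ k * α k = ∑ j, θ j * α j := by
    rw [Finset.sum_comm, ← h1]
    exact Finset.sum_congr rfl fun j _ => Finset.sum_congr rfl fun k _ => by ring
  have h3 : ∑ j, ∑ k, θ j * θ k * (b j * b k) = (∑ j, θ j * b j) ^ 2 := by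
    rw [sq, Finset.sum_mul_sum]
    exact Finset.sum_congr rfl fun j _ => Finset.sum_congr rfl fun k _ => by ring
  simp only [mul_add, Finset.sum_add_distrib, h1, h2, h3]
  ring

theorem sum_mul_sq_sub {θ : ι → ℝ} (hθ : ∑ j, θ j = 1) (x : ι → ℝ) (y : ℝ) :
    ∑ j, θ j * (y - x j) ^ 2 = y ^ 2 - 2 * y * ∑ j, θ j * x j + ∑ j, θ j * x j ^ 2 := by
  rw [← one_mul (y ^ 2), ← hθ, Finset.sum_mul, Finset.mul_sum, ← Finset.sum_sub_distrib,
    ← Finset.sum_add_distrib]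
  exact Finset.sum_congr rfl fun j _ => by ring

theorem sum_mul_sub {θ : ι → ℝ} (hθ : ∑ j, θ j = 1) (x : ι → ℝ) (r : ℝ) :
    ∑ j, θ j * (x j - r) = ∑ j, θ j * x j - r := by
  simp only [mul_sub, Finset.sum_sub_distrib, ← Finset.sum_mul, hθ, one_mul]

/-- The product term averages to `(f_θ - r)²`. The subtracted squares are re-expressed through the
variance identity `∑ θ_j (x_j - r)² = ∑ θ_j (y - x_j)² - (y - f_θ)² + (f_θ - r)²`, which turns the
average of individual losses into half of itself plus half the loss of the ensemble. -/
theorem sum_sum_mul_pairExcess {θ : ι → ℝ} (hθ : ∑ j, θ j = 1) (x : ι → ℝ) (y r : ℝ) :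
    ∑ j, ∑ k, θ j * θ k * pairExcess y r (x j) (x k) =
      1 / 2 * (y - ∑ j, θ j * x j) ^ 2 + 1 / 2 * ∑ j, θ j * (y - x j) ^ 2 +
        1 / 2 * (∑ j, θ j * x j - r) ^ 2 - (y - r) ^ 2 := by
  have h := sum_sum_mul_add_add_mul hθ
    (fun j => 1 / 2 * ((y - x j) ^ 2 - (y - r) ^ 2) - 1 / 4 * (r - x j) ^ 2) (fun j => x j - r)
  have h1 : ∑ j, θ j * (1 / 2 * ((y - x j) ^ 2 - (y - r) ^ 2) - 1 / 4 * (r - x j) ^ 2) =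
      1 / 2 * (∑ j, θ j * (y - x j) ^ 2) - 1 / 2 * (y - r) ^ 2 -
        1 / 4 * ∑ j, θ j * (r - x j) ^ 2 := by
    rw [← one_mul (1 / 2 * (y - r) ^ 2), ← hθ, Finset.sum_mul, Finset.mul_sum, Finset.mul_sum,
      ← Finset.sum_sub_distrib, ← Finset.sum_sub_distrib]
    exact Finset.sum_congr rfl fun j _ => by ring
  rw [h1, sum_mul_sub hθ, sum_mul_sq_sub hθ, sum_mul_sq_sub hθ] at h
  rw [sum_mul_sq_sub hθ]
  refine Eq.trans (Finset.sum_congr rfl fun j _ => Finset.sum_congr rfl fun k _ => ?_)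
    (h.trans ?_)
  · rw [pairExcess]; ring
  · ring

/-- The variance of the models under `θ` is the same around `y` as around `r`, so removing another
quarter of the squares leaves exactly the excess loss of the ensemble. In the risk bound this
quarter pays for the deviations. -/
theorem sum_sum_mul_pairExcess_sub {θ : ι → ℝ} (hθ : ∑ j, θ j = 1) (x : ι → ℝ) (y r : ℝ) :
    ∑ j, ∑ k, θ j * θ k * (pairExcess y r (x j) (x k) -
        1 / 4 * ((x j - r) ^ 2 + (x k - r) ^ 2)) =
      (y - ∑ j, θ j * x j) ^ 2 - (y - r) ^ 2 := by
  have h := sum_sum_mul_add_add_mul hθ (fun j => 1 / 4 * (r - x j) ^ 2) (fun _ => 0)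
  have h1 : ∑ j, θ j * (1 / 4 * (r - x j) ^ 2) = 1 / 4 * ∑ j, θ j * (r - x j) ^ 2 := by
    rw [Finset.mul_sum]
    exact Finset.sum_congr rfl fun j _ => by ring
  rw [h1, sum_mul_sq_sub hθ] at h
  have h2 := sum_sum_mul_pairExcess hθ x y r
  rw [sum_mul_sq_sub hθ] at h2
  simp only [mul_sub, Finset.sum_sub_distrib] at h h2 ⊢
  rw [h2]
  have h3 : ∑ j, ∑ k, θ j * θ k * (1 / 4 * ((x j - r) ^ 2 + (x k - r) ^ 2)) =
      ∑ j, ∑ k, θ j * θ k * (1 / 4 * (r - x j) ^ 2 + 1 / 4 * (r - x k) ^ 2 + 0 * 0) :=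
    Finset.sum_congr rfl fun j _ => Finset.sum_congr rfl fun k _ => by ring
  rw [h3, h]
  simp only [mul_zero, Finset.sum_const_zero]
  ring

theorem sq_sum_mul_sub_le {θ : ι → ℝ} (hθ0 : ∀ j, 0 ≤ θ j) (hθ : ∑ j, θ j = 1) (x : ι → ℝ)
    (r : ℝ) : (∑ j, θ j * x j - r) ^ 2 ≤ ∑ j, θ j * (x j - r) ^ 2 := by
  rw [← sum_mul_sub hθ]
  have h := sum_mul_sq_sub hθ (fun j => x j - r) (∑ j, θ j * (x j - r))
  have h0 : 0 ≤ ∑ j, θ j * ((∑ j, θ j * (x j - r)) - (x j - r)) ^ 2 :=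
    Finset.sum_nonneg fun j _ => mul_nonneg (hθ0 j) (sq_nonneg _)
  nlinarith

theorem abs_sum_mul_le {θ : ι → ℝ} (hθ0 : ∀ j, 0 ≤ θ j) (hθ : ∑ j, θ j = 1) {x : ι → ℝ} {U : ℝ}
    (hx : ∀ j, |x j| ≤ U) : |∑ j, θ j * x j| ≤ U := by
  calc |∑ j, θ j * x j| ≤ ∑ j, |θ j * x j| := Finset.abs_sum_le_sum_abs _ _
    _ ≤ ∑ j, θ j * U := Finset.sum_le_sum fun j _ => by
        rw [abs_mul, abs_of_nonneg (hθ0 j)]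
        exact mul_le_mul_of_nonneg_left (hx j) (hθ0 j)
    _ = U := by rw [← Finset.sum_mul, hθ, one_mul]

/-- Each summand carries a factor `u - r` or `v - r`. This is the Bernstein condition: fluctuations
shrink with the distance of the models to the reference. -/
theorem pairExcess_eq (y r u v : ℝ) :
    pairExcess y r u v = (u - r) * (1 / 4 * u + 3 / 4 * r - y + 1 / 2 * (v - r)) +
      (v - r) * (1 / 4 * v + 3 / 4 * r - y + 1 / 2 * (u - r)) := by
  rw [pairExcess]; ring

theorem abs_pairExcess_factor_le {y r u v U : ℝ} (hy : |y| ≤ U) (hr : |r| ≤ U) (hu : |u| ≤ U)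
    (hv : |v| ≤ U) : |1 / 4 * u + 3 / 4 * r - y + 1 / 2 * (v - r)| ≤ 3 * U := by
  rw [abs_le] at *
  constructor <;> linarith

theorem abs_pairExcess_le {y r u v U : ℝ} (hy : |y| ≤ U) (hr : |r| ≤ U) (hu : |u| ≤ U)
    (hv : |v| ≤ U) : |pairExcess y r u v| ≤ 12 * U ^ 2 := by
  have hU : 0 ≤ U := (abs_nonneg _).trans hy
  have hu' : |u - r| ≤ 2 * U := by rw [abs_le] at *; constructor <;> linarith
  have hv' : |v - r| ≤ 2 * U := by rw [abs_le] at *; constructor <;> linarith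
  rw [pairExcess_eq]
  refine (abs_add_le _ _).trans ?_
  rw [abs_mul, abs_mul]
  have h1 := mul_le_mul hu' (abs_pairExcess_factor_le hy hr hu hv) (abs_nonneg _) (by linarith)
  have h2 := mul_le_mul hv' (abs_pairExcess_factor_le hy hr hv hu) (abs_nonneg _) (by linarith)
  nlinarith

theorem pairExcess_sq_le {y r u v U : ℝ} (hy : |y| ≤ U) (hr : |r| ≤ U) (hu : |u| ≤ U)
    (hv : |v| ≤ U) :
    pairExcess y r u v ^ 2 ≤ 18 * U ^ 2 * ((u - r) ^ 2 + (v - r) ^ 2) := by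
  rw [pairExcess_eq]
  have h1 := sq_le_sq' (neg_le_of_abs_le (abs_pairExcess_factor_le hy hr hu hv))
    (le_of_abs_le (abs_pairExcess_factor_le hy hr hu hv))
  have h2 := sq_le_sq' (neg_le_of_abs_le (abs_pairExcess_factor_le hy hr hv hu))
    (le_of_abs_le (abs_pairExcess_factor_le hy hr hv hu))
  set a := 1 / 4 * u + 3 / 4 * r - y + 1 / 2 * (v - r)
  set b := 1 / 4 * v + 3 / 4 * r - y + 1 / 2 * (u - r)
  have h3 := mul_le_mul_of_nonneg_left h1 (sq_nonneg (u - r))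
  have h4 := mul_le_mul_of_nonneg_left h2 (sq_nonneg (v - r))
  -- `(A + B)² ≤ 2 A² + 2 B²` with both factors bounded by `3 U`, hence `18 U² = 2 · (3 U)²`.
  nlinarith [sq_nonneg ((u - r) * a - (v - r) * b)]

/-- The modified loss interpolates along a segment towards a vertex with a quadratic gap. -/
theorem sq_add_sum_segment {θ : ι → ℝ} [DecidableEq ι] (x : ι → ℝ) (y t : ℝ) (J : ι) :
    1 / 2 * (y - ∑ j, ((1 - t) * θ j + t * (Pi.single J 1 : ι → ℝ) j) * x j) ^ 2 +
        1 / 2 * ∑ j, ((1 - t) * θ j + t * (Pi.single J 1 : ι → ℝ) j) * (y - x j) ^ 2 =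
      (1 - t) * (1 / 2 * (y - ∑ j, θ j * x j) ^ 2 + 1 / 2 * ∑ j, θ j * (y - x j) ^ 2) +
        t * (y - x J) ^ 2 - 1 / 2 * (t * (1 - t)) * (∑ j, θ j * x j - x J) ^ 2 := by
  have h : ∀ a : ι → ℝ, ∑ j, ((1 - t) * θ j + t * (Pi.single J 1 : ι → ℝ) j) * a j =
      (1 - t) * ∑ j, θ j * a j + t * a J := by
    intro a
    simp only [add_mul, Finset.sum_add_distrib, mul_assoc, ← Finset.mul_sum]
    simp [Pi.single_apply]
  rw [h, h]
  ring

theorem add_le_of_forall_one_sub_mul {a N b : ℝ}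
    (h : ∀ t : ℝ, 0 < t → t ≤ 1 → a + (1 - t) * N ≤ b) : a + N ≤ b := by
  have ht : Filter.Tendsto (fun t : ℝ => a + (1 - t) * N) (nhdsWithin 0 (Set.Ioi 0))
      (nhds (a + N)) := by
    have : Continuous fun t : ℝ => a + (1 - t) * N := by fun_prop
    simpa using (this.tendsto 0).mono_left nhdsWithin_le_nhds
  refine le_of_tendsto ht ?_
  filter_upwards [Ioc_mem_nhdsGT (zero_lt_one (α := ℝ))] with t h'
  exact h t h'.1 h'.2

end Algebra

/-! ### First-order optimality with a curvature gain -/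

section Optimality

variable {𝒲 𝒳 : Type*} {M n : ℕ}

/-- The averaged pair excess of a Q-aggregate with respect to any model is at most the difference
of the penalties. -/
theorem IsQAggregate.sum_pairExcess_le {β : ℝ} {prior : Fin M → ℝ} {proj : 𝒲 → 𝒳}
    {h a : ℝ → 𝒲 → ℝ} {f : Fin M → 𝒳 → ℝ} {z : Fin n → 𝒲 × ℝ × ℝ} {θ : Fin M → ℝ}
    (hθ : IsQAggregate (1 / 2) β prior proj h a f z θ) (J : Fin M) :
    (1 / (n : ℝ)) * ∑ i, ∑ j, ∑ k, θ j * θ k * pairExcess (drLabel h a (z i))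
        (f J (proj (z i).1)) (f j (proj (z i).1)) (f k (proj (z i).1)) +
      β / n * ∑ j, θ j * Real.log (1 / prior j) ≤ β / n * Real.log (1 / prior J) := by
  obtain ⟨⟨hθ0, hθ1⟩, hmin⟩ := hθ
  have hvert : (Pi.single J 1 : Fin M → ℝ) ∈ stdSimplex ℝ (Fin M) := single_mem_stdSimplex ℝ J
  set m : Fin n → ℝ := fun i => 1 / 2 * (drLabel h a (z i) - ∑ j, θ j * f j (proj (z i).1)) ^ 2 +
    1 / 2 * ∑ j, θ j * (drLabel h a (z i) - f j (proj (z i).1)) ^ 2 with hm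
  set l : Fin n → ℝ := fun i => (drLabel h a (z i) - f J (proj (z i).1)) ^ 2 with hl
  set s : Fin n → ℝ := fun i => (∑ j, θ j * f j (proj (z i).1) - f J (proj (z i).1)) ^ 2 with hs
  have hF : qObjective (1 / 2) β prior proj h a f z θ =
      (1 / (n : ℝ)) * ∑ i, m i + β / n * ∑ j, θ j * Real.log (1 / prior j) := by
    simp only [qObjective, modifiedLoss, drLoss, ensemble, hm]
    norm_num
  have key : ∀ t : ℝ, 0 < t → t ≤ 1 →
      ((1 / (n : ℝ)) * ∑ i, m i + β / n * ∑ j, θ j * Real.log (1 / prior j)) +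
        (1 - t) * (1 / 2 * ((1 / (n : ℝ)) * ∑ i, s i)) ≤
      (1 / (n : ℝ)) * ∑ i, l i + β / n * Real.log (1 / prior J) := by
    intro t ht0 ht1
    have hmem : (1 - t) • θ + t • (Pi.single J 1 : Fin M → ℝ) ∈ stdSimplex ℝ (Fin M) :=
      convex_stdSimplex ℝ (Fin M) ⟨hθ0, hθ1⟩ hvert (by linarith) ht0.le (by ring)
    have hle := hmin _ hmem
    have hloss : ∀ i, modifiedLoss (1 / 2) proj h a f ((1 - t) • θ + t • (Pi.single J 1 : Fin M → ℝ))
        (z i) = (1 - t) * m i + t * l i - 1 / 2 * (t * (1 - t)) * s i := by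
      intro i
      have := sq_add_sum_segment (θ := θ) (fun j => f j (proj (z i).1)) (drLabel h a (z i)) t J
      simp only [modifiedLoss, drLoss, ensemble, Pi.add_apply, Pi.smul_apply, smul_eq_mul, hm, hl,
        hs]
      rw [← this]
      norm_num
    have hpen : ∑ j, ((1 - t) • θ + t • (Pi.single J 1 : Fin M → ℝ)) j * Real.log (1 / prior j) =
        (1 - t) * ∑ j, θ j * Real.log (1 / prior j) + t * Real.log (1 / prior J) := by
      simp only [Pi.add_apply, Pi.smul_apply, smul_eq_mul, add_mul, Finset.sum_add_distrib,
        mul_assoc, ← Finset.mul_sum]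
      simp [Pi.single_apply]
    have hsum : ∑ i, modifiedLoss (1 / 2) proj h a f
        ((1 - t) • θ + t • (Pi.single J 1 : Fin M → ℝ)) (z i) =
        (1 - t) * ∑ i, m i + t * ∑ i, l i - 1 / 2 * (t * (1 - t)) * ∑ i, s i := by
      rw [Finset.sum_congr rfl fun i _ => hloss i, Finset.sum_sub_distrib,
        Finset.sum_add_distrib, ← Finset.mul_sum, ← Finset.mul_sum, ← Finset.mul_sum]
    rw [hF] at hle
    unfold qObjective at hle
    rw [hpen, hsum] at hle
    -- Everything surviving the comparison of `θ` with the segment point is proportional to `t`.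
    -- Dividing by `t` leaves the curvature with factor `1 - t`, which the limit `t → 0` turns into
    -- the full gain.
    refine le_of_mul_le_mul_left ?_ ht0
    linear_combination hle
  have h2 := add_le_of_forall_one_sub_mul key
  have h3 : ∀ i, ∑ j, ∑ k, θ j * θ k * pairExcess (drLabel h a (z i))
      (f J (proj (z i).1)) (f j (proj (z i).1)) (f k (proj (z i).1)) =
      m i + 1 / 2 * s i - l i := fun i =>
    sum_sum_mul_pairExcess hθ1 (fun j => f j (proj (z i).1)) _ _
  rw [Finset.sum_congr rfl fun i _ => h3 i, Finset.sum_sub_distrib, Finset.sum_add_distrib,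
    ← Finset.mul_sum]
  linear_combination h2

/-- For a constant prior the penalty does not affect the aggregate. -/
theorem IsQAggregate.of_const_prior {ν β c : ℝ} (β' : ℝ) {proj : 𝒲 → 𝒳}
    {h a : ℝ → 𝒲 → ℝ} {f : Fin M → 𝒳 → ℝ} {z : Fin n → 𝒲 × ℝ × ℝ} {θ : Fin M → ℝ}
    (hθ : IsQAggregate ν β (fun _ => c) proj h a f z θ) :
    IsQAggregate ν β' (fun _ => c) proj h a f z θ := by
  refine ⟨hθ.1, fun θ' hθ' => ?_⟩
  have h1 := hθ.2 θ' hθ'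
  simp only [qObjective, ← Finset.sum_mul, hθ.1.2, hθ'.2] at h1 ⊢
  linarith

end Optimality

/-! ### From the empirical to the population excess risk -/

section Population

variable {𝒵 ι : Type*} [MeasurableSpace 𝒵] [Fintype ι] {μ : Measure 𝒵} [IsProbabilityMeasure μ]
  {ψ r : 𝒵 → ℝ} {x : ι → 𝒵 → ℝ} {U : ℝ}

theorem measurable_pairExcess {α : Type*} [MeasurableSpace α] {y r u v : α → ℝ}
    (hy : Measurable y) (hr : Measurable r) (hu : Measurable u) (hv : Measurable v) :
    Measurable fun z => pairExcess (y z) (r z) (u z) (v z) := by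
  unfold pairExcess
  fun_prop

theorem integrable_sub_sq {u v : 𝒵 → ℝ} (hu : Measurable u) (hv : Measurable v)
    (hub : ∀ᵐ z ∂μ, |u z| ≤ U) (hvb : ∀ᵐ z ∂μ, |v z| ≤ U) :
    Integrable (fun z => (u z - v z) ^ 2) μ := by
  refine integrable_sq_of_abs_le (hu.sub hv).aestronglyMeasurable (B := U + U) ?_
  filter_upwards [hub, hvb] with z h1 h2
  exact (abs_sub _ _).trans (add_le_add h1 h2)

theorem integrable_pairExcess {u v : 𝒵 → ℝ} (hψ : Measurable ψ) (hr : Measurable r)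
    (hu : Measurable u) (hv : Measurable v) (hψb : ∀ᵐ z ∂μ, |ψ z| ≤ U)
    (hrb : ∀ᵐ z ∂μ, |r z| ≤ U) (hub : ∀ᵐ z ∂μ, |u z| ≤ U) (hvb : ∀ᵐ z ∂μ, |v z| ≤ U) :
    Integrable (fun z => pairExcess (ψ z) (r z) (u z) (v z)) μ := by
  refine integrable_of_abs_le (measurable_pairExcess hψ hr hu hv).aestronglyMeasurable
    (B := 12 * U ^ 2) ?_
  filter_upwards [hψb, hrb, hub, hvb] with z h1 h2 h3 h4
  exact abs_pairExcess_le h1 h2 h3 h4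

theorem integral_pairExcess_sq_le {u v : 𝒵 → ℝ} (hψ : Measurable ψ) (hr : Measurable r)
    (hu : Measurable u) (hv : Measurable v) (hψb : ∀ᵐ z ∂μ, |ψ z| ≤ U)
    (hrb : ∀ᵐ z ∂μ, |r z| ≤ U) (hub : ∀ᵐ z ∂μ, |u z| ≤ U) (hvb : ∀ᵐ z ∂μ, |v z| ≤ U) :
    ∫ z, pairExcess (ψ z) (r z) (u z) (v z) ^ 2 ∂μ ≤
      18 * U ^ 2 * ((∫ z, (u z - r z) ^ 2 ∂μ) + ∫ z, (v z - r z) ^ 2 ∂μ) := by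
  have h1 := integrable_sub_sq hu hr hub hrb
  have h2 := integrable_sub_sq hv hr hvb hrb
  rw [← integral_add h1 h2, ← integral_const_mul]
  refine integral_mono_ae ?_ ((h1.add h2).const_mul _) ?_
  · refine integrable_sq_of_abs_le (measurable_pairExcess hψ hr hu hv).aestronglyMeasurable
      (B := 12 * U ^ 2) ?_
    filter_upwards [hψb, hrb, hub, hvb] with z h1 h2 h3 h4
    exact abs_pairExcess_le h1 h2 h3 h4
  · filter_upwards [hψb, hrb, hub, hvb] with z h1 h2 h3 h4
    exact pairExcess_sq_le h1 h2 h3 h4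

theorem integral_ensemble_excess {θ : ι → ℝ} (hθ0 : ∀ j, 0 ≤ θ j) (hθ : ∑ j, θ j = 1)
    (hψ : Measurable ψ) (hr : Measurable r) (hx : ∀ j, Measurable (x j))
    (hψb : ∀ᵐ z ∂μ, |ψ z| ≤ U) (hrb : ∀ᵐ z ∂μ, |r z| ≤ U) (hxb : ∀ j, ∀ᵐ z ∂μ, |x j z| ≤ U) :
    (∫ z, (ψ z - ∑ j, θ j * x j z) ^ 2 ∂μ) - ∫ z, (ψ z - r z) ^ 2 ∂μ =
      ∑ j, ∑ k, θ j * θ k * ((∫ z, pairExcess (ψ z) (r z) (x j z) (x k z) ∂μ) -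
        1 / 4 * ((∫ z, (x j z - r z) ^ 2 ∂μ) + ∫ z, (x k z - r z) ^ 2 ∂μ)) := by
  have hD := fun j => integrable_sub_sq (hx j) hr (hxb j) hrb
  have hG := fun j k => integrable_pairExcess hψ hr (hx j) (hx k) hψb hrb (hxb j) (hxb k)
  have he : Measurable fun z => ∑ j, θ j * x j z := by fun_prop
  have heb : ∀ᵐ z ∂μ, |∑ j, θ j * x j z| ≤ U := by
    filter_upwards [ae_all_iff.2 hxb] with z hz
    exact abs_sum_mul_le hθ0 hθ hz
  have hH : ∀ j k, Integrable (fun z => pairExcess (ψ z) (r z) (x j z) (x k z) -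
      1 / 4 * ((x j z - r z) ^ 2 + (x k z - r z) ^ 2)) μ := fun j k =>
    (hG j k).sub (((hD j).add (hD k)).const_mul _)
  rw [← integral_sub (integrable_sub_sq hψ he hψb heb) (integrable_sub_sq hψ hr hψb hrb)]
  simp only [← sum_sum_mul_pairExcess_sub hθ]
  rw [integral_finsetSum _ fun j _ => integrable_finsetSum _ fun k _ => (hH j k).const_mul _]
  refine Finset.sum_congr rfl fun j _ => ?_
  rw [integral_finsetSum _ fun k _ => (hH j k).const_mul _]
  refine Finset.sum_congr rfl fun k _ => ?_
  rw [integral_const_mul]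
  congr 1
  have hS : Integrable (fun z => 1 / 4 * ((x j z - r z) ^ 2 + (x k z - r z) ^ 2)) μ :=
    ((hD j).add (hD k)).const_mul _
  rw [integral_sub (hG j k) hS, integral_const_mul, integral_add (hD j) (hD k)]

theorem integral_ensemble_sub_sq_le {θ : ι → ℝ} (hθ0 : ∀ j, 0 ≤ θ j) (hθ : ∑ j, θ j = 1)
    (hr : Measurable r) (hx : ∀ j, Measurable (x j))
    (hrb : ∀ᵐ z ∂μ, |r z| ≤ U) (hxb : ∀ j, ∀ᵐ z ∂μ, |x j z| ≤ U) :
    ∫ z, (∑ j, θ j * x j z - r z) ^ 2 ∂μ ≤ ∑ j, θ j * ∫ z, (x j z - r z) ^ 2 ∂μ := by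
  have hD := fun j => integrable_sub_sq (hx j) hr (hxb j) hrb
  have he : Measurable fun z => ∑ j, θ j * x j z := by fun_prop
  have heb : ∀ᵐ z ∂μ, |∑ j, θ j * x j z| ≤ U := by
    filter_upwards [ae_all_iff.2 hxb] with z hz
    exact abs_sum_mul_le hθ0 hθ hz
  calc ∫ z, (∑ j, θ j * x j z - r z) ^ 2 ∂μ
      ≤ ∫ z, ∑ j, θ j * (x j z - r z) ^ 2 ∂μ :=
        integral_mono (integrable_sub_sq he hr heb hrb)
          (integrable_finsetSum _ fun j _ => (hD j).const_mul _)
          fun z => sq_sum_mul_sub_le hθ0 hθ _ _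
    _ = _ := by
        rw [integral_finsetSum _ fun j _ => (hD j).const_mul _]
        simp only [integral_const_mul]

/-- The excess risk of an ensemble whose averaged empirical pair excess is small, on the event
that the pair excesses do not fall much below their means. -/
theorem excess_le_of_deviation {n : ℕ} (hn : 1 ≤ n) (hU : 0 < U) {β L c : ℝ} {θ prior : ι → ℝ}
    (hθ0 : ∀ j, 0 ≤ θ j) (hθ : ∑ j, θ j = 1) (hπ : ∀ j, 0 < prior j) (hπ1 : ∀ j, prior j ≤ 1)
    (hβ : 112 * U ^ 2 ≤ β) {z : Fin n → 𝒵}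
    (hψ : Measurable ψ) (hr : Measurable r) (hx : ∀ j, Measurable (x j))
    (hψb : ∀ᵐ z ∂μ, |ψ z| ≤ U) (hrb : ∀ᵐ z ∂μ, |r z| ≤ U) (hxb : ∀ j, ∀ᵐ z ∂μ, |x j z| ≤ U)
    (hdev : ∀ j k, ∑ i, 1 / (56 * U ^ 2) *
        ((∫ y, pairExcess (ψ y) (r y) (x j y) (x k y) ∂μ) -
          pairExcess (ψ (z i)) (r (z i)) (x j (z i)) (x k (z i))) ≤
      n * (3 / 4 * (1 / (56 * U ^ 2)) ^ 2 *
        ∫ y, pairExcess (ψ y) (r y) (x j y) (x k y) ^ 2 ∂μ) +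
        Real.log (1 / (prior j * prior k)) + L)
    (hopt : (1 / (n : ℝ)) * ∑ i, ∑ j, ∑ k, θ j * θ k *
        pairExcess (ψ (z i)) (r (z i)) (x j (z i)) (x k (z i)) +
      β / n * ∑ j, θ j * Real.log (1 / prior j) ≤ c) :
    (∫ y, (ψ y - ∑ j, θ j * x j y) ^ 2 ∂μ) + 1 / 56 * ∫ y, (∑ j, θ j * x j y - r y) ^ 2 ∂μ ≤
      (∫ y, (ψ y - r y) ^ 2 ∂μ) + c + 56 * U ^ 2 / n * L := by
  have hn0 : (0 : ℝ) < n := by exact_mod_cast hn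
  set m : ι → ι → ℝ := fun j k => ∫ y, pairExcess (ψ y) (r y) (x j y) (x k y) ∂μ with hm
  set d : ι → ℝ := fun j => ∫ y, (x j y - r y) ^ 2 ∂μ with hd
  set e : ι → ι → ℝ := fun j k => 1 / (n : ℝ) *
    ∑ i, pairExcess (ψ (z i)) (r (z i)) (x j (z i)) (x k (z i)) with he
  set l : ι → ℝ := fun j => Real.log (1 / prior j) with hl
  have hexc := integral_ensemble_excess hθ0 hθ hψ hr hx hψb hrb hxb
  have hsq := integral_ensemble_sub_sq_le hθ0 hθ hr hx hrb hxb
  -- Multiplying the deviation bound by `56 U² / n` gives the second moment the coefficient `(3/4) ·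
  -- 18 / 56 = 27/112`. This is just below `1/4 = 28/112`, so `-1/112` of each squared distance
  -- survives.
  have hdev' : ∀ j k, m j k - 1 / 4 * (d j + d k) ≤
      e j k + ((56 * U ^ 2 / n * l j - 1 / 112 * d j) + (56 * U ^ 2 / n * l k - 1 / 112 * d k) +
        56 * U ^ 2 / n * L) := by
    intro j k
    have h1 := hdev j k
    have h2 := integral_pairExcess_sq_le hψ hr (hx j) (hx k) hψb hrb (hxb j) (hxb k)
    have hlog : Real.log (1 / (prior j * prior k)) = l j + l k := by
      rw [hl, ← Real.log_mul (one_div_pos.2 (hπ j)).ne' (one_div_pos.2 (hπ k)).ne',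
        one_div_mul_one_div]
    have hsum : ∑ i, 1 / (56 * U ^ 2) *
        ((∫ y, pairExcess (ψ y) (r y) (x j y) (x k y) ∂μ) -
          pairExcess (ψ (z i)) (r (z i)) (x j (z i)) (x k (z i))) =
        n / (56 * U ^ 2) * (m j k - e j k) := by
      rw [← Finset.mul_sum, Finset.sum_sub_distrib, Finset.sum_const, Finset.card_univ,
        Fintype.card_fin, nsmul_eq_mul, hm, he]
      field_simp
    rw [hsum, hlog] at h1
    have h3 : (n : ℝ) * (3 / 4 * (1 / (56 * U ^ 2)) ^ 2 *
        ∫ y, pairExcess (ψ y) (r y) (x j y) (x k y) ^ 2 ∂μ) ≤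
        n * (3 / 4 * (1 / (56 * U ^ 2)) ^ 2 * (18 * U ^ 2 * (d j + d k))) := by
      have : (0 : ℝ) ≤ 3 / 4 * (1 / (56 * U ^ 2)) ^ 2 := by positivity
      exact mul_le_mul_of_nonneg_left (mul_le_mul_of_nonneg_left h2 this) hn0.le
    have h4 := h1.trans (add_le_add_left (add_le_add_left h3 _) _)
    have h5 := mul_le_mul_of_nonneg_left h4 (show 0 ≤ 56 * U ^ 2 / (n : ℝ) by positivity)
    have h6 : 56 * U ^ 2 / (n : ℝ) * (n / (56 * U ^ 2) * (m j k - e j k)) = m j k - e j k := by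
      field_simp
    have h7 : 56 * U ^ 2 / (n : ℝ) * (n * (3 / 4 * (1 / (56 * U ^ 2)) ^ 2 *
        (18 * U ^ 2 * (d j + d k))) + (l j + l k) + L) =
        27 / 112 * (d j + d k) + 56 * U ^ 2 / n * l j + 56 * U ^ 2 / n * l k +
          56 * U ^ 2 / n * L := by
      field_simp
      ring
    rw [h6, h7] at h5
    linarith
  -- The right side is put in the form `α_j + α_k + b_j b_k` with `b = 0`, the constant term in `L`
  -- being split equally between the two indices.
  have hsum1 : ∑ j, ∑ k, θ j * θ k * (m j k - 1 / 4 * (d j + d k)) ≤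
      ∑ j, ∑ k, θ j * θ k * e j k + ∑ j, ∑ k, θ j * θ k *
        ((56 * U ^ 2 / n * l j - 1 / 112 * d j + 1 / 2 * (56 * U ^ 2 / n * L)) +
          (56 * U ^ 2 / n * l k - 1 / 112 * d k + 1 / 2 * (56 * U ^ 2 / n * L)) + 0 * 0) := by
    simp only [← Finset.sum_add_distrib]
    refine Finset.sum_le_sum fun j _ => Finset.sum_le_sum fun k _ => ?_
    rw [← mul_add]
    refine mul_le_mul_of_nonneg_left ?_ (mul_nonneg (hθ0 j) (hθ0 k))
    linarith [hdev' j k]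
  rw [sum_sum_mul_add_add_mul hθ
    (fun j => 56 * U ^ 2 / n * l j - 1 / 112 * d j + 1 / 2 * (56 * U ^ 2 / n * L))
    (fun _ => 0)] at hsum1
  have hlin : ∑ j, θ j * (56 * U ^ 2 / n * l j - 1 / 112 * d j + 1 / 2 * (56 * U ^ 2 / n * L)) =
      56 * U ^ 2 / n * ∑ j, θ j * l j - 1 / 112 * ∑ j, θ j * d j +
        1 / 2 * (56 * U ^ 2 / n * L) := by
    simp only [mul_add, mul_sub, Finset.sum_add_distrib, Finset.sum_sub_distrib,
      ← Finset.sum_mul, hθ, one_mul, mul_left_comm (θ _), ← Finset.mul_sum]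
  have hemp : ∑ j, ∑ k, θ j * θ k * e j k = (1 / (n : ℝ)) * ∑ i, ∑ j, ∑ k, θ j * θ k *
      pairExcess (ψ (z i)) (r (z i)) (x j (z i)) (x k (z i)) := by
    rw [Finset.sum_comm (s := (Finset.univ : Finset (Fin n))), Finset.mul_sum]
    refine Finset.sum_congr rfl fun j _ => ?_
    rw [Finset.sum_comm (s := (Finset.univ : Finset (Fin n))), Finset.mul_sum]
    refine Finset.sum_congr rfl fun k _ => ?_
    rw [he, ← Finset.mul_sum]
    ring
  have hl0 : 0 ≤ ∑ j, θ j * l j := Finset.sum_nonneg fun j _ => mul_nonneg (hθ0 j)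
    (Real.log_nonneg ((one_le_div (hπ j)).2 (hπ1 j)))
  -- Both indices of a pair pay `56 U² / n` times their log-prior, so the penalty must have strength
  -- at least `112 U²`. This is the source of the lower bound on `β`.
  have hpen : 112 * U ^ 2 / n * ∑ j, θ j * l j ≤ β / n * ∑ j, θ j * l j :=
    mul_le_mul_of_nonneg_right (div_le_div_of_nonneg_right hβ hn0.le) hl0
  rw [hlin, hemp] at hsum1
  simp only [mul_zero, Finset.sum_const_zero] at hsum1
  have hpen' : 112 * U ^ 2 / n * ∑ j, θ j * l j = 2 * (56 * U ^ 2 / n * ∑ j, θ j * l j) := by ring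
  linarith

end Population

/-! ### The doubly robust label is conditionally unbiased up to the nuisance product -/

section Causal

variable {Ω 𝒲 𝒳 β : Type*} {m : MeasurableSpace Ω} [mΩ : MeasurableSpace Ω] [MeasurableSpace 𝒲] [MeasurableSpace 𝒳]
  [MeasurableSpace β] {P : Measure Ω} [IsProbabilityMeasure P]

theorem integral_mul_eq_zero_of_condExp (hm : m ≤ mΩ) {g ξ : Ω → ℝ}
    (hg : StronglyMeasurable[m] g) (hξ : Integrable ξ P) (hgξ : Integrable (g * ξ) P)
    (h0 : P[ξ | m] =ᵐ[P] 0) : ∫ ω, g ω * ξ ω ∂P = 0 := by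
  have h1 := condExp_mul_of_stronglyMeasurable_left hg hgξ hξ
  have h2 : ∫ ω, (g * ξ) ω ∂P = ∫ ω, (P[g * ξ | m]) ω ∂P := (integral_condExp hm).symm
  have h3 : ∫ ω, (P[g * ξ | m]) ω ∂P = 0 := by
    refine integral_eq_zero_of_ae ?_
    filter_upwards [h1, h0] with ω h1 h0
    simp [h1, h0]
  exact h2.trans h3

theorem condExp_sub_condExp (hm : m ≤ mΩ) {ξ : Ω → ℝ}
    (hξ : Integrable ξ P) : P[ξ - P[ξ | m] | m] =ᵐ[P] 0 := by
  filter_upwards [condExp_sub hξ integrable_condExp m] with ω h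
  rw [h, Pi.sub_apply, condExp_of_stronglyMeasurable hm stronglyMeasurable_condExp
    integrable_condExp, sub_self, Pi.zero_apply]

theorem integrable_of_zero_or_one {D : Ω → ℝ} (hD : Measurable D)
    (hD01 : ∀ᵐ ω ∂P, D ω = 0 ∨ D ω = 1) : Integrable D P := by
  refine Integrable.of_bound hD.aestronglyMeasurable 1 ?_
  filter_upwards [hD01] with ω h
  rcases h with h | h <;> simp [h]

/-- The treatment residual is orthogonal to products of a function of the covariates and a function
of the potential outcomes. -/
theorem integral_residual_mul_eq_zero (hm : m ≤ mΩ) {F : Ω → β}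
    {D : Ω → ℝ} (hF : Measurable F) (hD : Measurable D)
    (hD01 : ∀ᵐ ω ∂P, D ω = 0 ∨ D ω = 1) (hci : CondIndepGiven P m F D)
    (hp : ∀ᵐ ω ∂P, 0 < (P[D | m]) ω ∧ (P[D | m]) ω < 1) {g φ : Ω → ℝ} {c : ℝ}
    (hg : StronglyMeasurable[m] g) (hgc : ∀ ω, |g ω| ≤ c)
    (hφ : StronglyMeasurable[sigmaOf F] φ) (hφi : Integrable φ P) :
    Integrable (fun ω => φ ω * (g ω * (D ω - (P[D | m]) ω))) P ∧
      ∫ ω, φ ω * (g ω * (D ω - (P[D | m]) ω)) ∂P = 0 := by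
  have hσF : sigmaOf F ≤ mΩ := hF.comap_le
  have hDi := integrable_of_zero_or_one hD hD01
  set p := P[D | m] with hpdef
  have hpm : StronglyMeasurable[m] p := stronglyMeasurable_condExp
  have hr1 : ∀ᵐ ω ∂P, |D ω - p ω| ≤ 1 := by
    filter_upwards [hD01, hp] with ω h1 h2
    rw [abs_le]
    rcases h1 with h | h <;> rw [h] <;> constructor <;> linarith
  have hrm : AEStronglyMeasurable (fun ω => D ω - p ω) P :=
    hD.aestronglyMeasurable.sub (hpm.mono hm).aestronglyMeasurable
  set ξ : Ω → ℝ := fun ω => g ω * (D ω - p ω) with hξ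
  have hξm : AEStronglyMeasurable ξ P := (hg.mono hm).aestronglyMeasurable.mul hrm
  have hξb : ∀ᵐ ω ∂P, ‖ξ ω‖ ≤ c := by
    filter_upwards [hr1] with ω h
    rw [Real.norm_eq_abs, hξ, abs_mul]
    exact (mul_le_of_le_one_right (abs_nonneg _) h).trans (hgc ω)
  have hξi : Integrable ξ P := Integrable.of_bound hξm c hξb
  have hφξ : Integrable (φ * ξ) P := hφi.mul_bdd hξm hξb
  refine ⟨hφξ, integral_mul_eq_zero_of_condExp hσF hφ hξi hφξ ?_⟩
  -- Conditioning on `F` first lets `φ` be merely integrable. It remains to test `g (D - p)` against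
  -- events of `F`, where only bounded variables occur.
  refine (ae_eq_condExp_of_forall_setIntegral_eq hσF hξi (fun _ _ _ => integrableOn_zero)
    ?_ aestronglyMeasurable_zero).symm
  rintro _ ⟨s, hs, rfl⟩ -
  have hS : MeasurableSet (F ⁻¹' s) := hF hs
  set I : Ω → ℝ := (F ⁻¹' s).indicator fun _ => (1 : ℝ) with hI
  have hIi : Integrable I P := (integrable_const _).indicator hS
  have hIb : ∀ ω, ‖I ω‖ ≤ 1 := fun ω => by
    by_cases h1 : ω ∈ F ⁻¹' s <;> simp [hI, h1]
  set ζ : Ω → ℝ := fun ω => I ω * (D ω - p ω) with hζ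
  have hζb : ∀ᵐ ω ∂P, ‖ζ ω‖ ≤ 1 := by
    filter_upwards [hr1] with ω h
    rw [hζ, norm_mul]
    exact mul_le_one₀ (hIb ω) (norm_nonneg _) h
  have hζi : Integrable ζ P := Integrable.of_bound (hIi.1.mul hrm) 1 hζb
  have hgζ : Integrable (g * ζ) P :=
    hζi.bdd_mul (hg.mono hm).aestronglyMeasurable (Filter.Eventually.of_forall hgc)
  have hIp : Integrable (p * I) P := by
    refine hIi.bdd_mul (c := 1) (hpm.mono hm).aestronglyMeasurable ?_
    filter_upwards [hp] with ω h
    rw [Real.norm_eq_abs, abs_of_pos h.1]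
    exact h.2.le
  have hprod : ∀ᵐ ω ∂P, ((F ⁻¹' s ∩ D ⁻¹' {1}).indicator fun _ => (1 : ℝ)) ω = I ω * D ω := by
    filter_upwards [hD01] with ω h
    by_cases h1 : ω ∈ F ⁻¹' s <;> rcases h with h | h <;>
      simp_all
  have hDind : ∀ᵐ ω ∂P, ((D ⁻¹' {1}).indicator fun _ => (1 : ℝ)) ω = D ω := by
    filter_upwards [hD01] with ω h
    rcases h with h | h <;> simp [h]
  have hID : Integrable (fun ω => I ω * D ω) P :=
    ((integrable_const (1 : ℝ)).indicator
      (hS.inter (hD (measurableSet_singleton 1)))).congr hprod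
  -- As `D` is the indicator of `D = 1`, conditional independence for the set `{1}` gives `E[I D |
  -- m] = E[I | m] p`, and `p` pulls out of `E[p I | m]`.
  have hζ0 : P[ζ | m] =ᵐ[P] 0 := by
    have e1 : ζ = (fun ω => I ω * D ω) - p * I := by
      ext ω
      simp only [hζ, Pi.sub_apply, Pi.mul_apply]
      ring
    have e2 := hci s {1} hs (measurableSet_singleton 1)
    have e3 := condExp_congr_ae (m := m) (μ := P) hprod
    have e4 := condExp_congr_ae (m := m) (μ := P) hDind
    have e5 := condExp_mul_of_stronglyMeasurable_left hpm hIp hIi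
    rw [e1]
    filter_upwards [condExp_sub hID hIp m, e2, e3, e4, e5] with ω f1 f2 f3 f4 f5
    rw [f1, Pi.sub_apply, ← f3, f2, f5, Pi.mul_apply]
    have f4' : (P[(D ⁻¹' {1}).indicator fun _ => (1 : ℝ) | m]) ω = p ω := f4
    rw [f4', Pi.zero_apply]
    ring
  have hfin := integral_mul_eq_zero_of_condExp hm hg hζi hgζ hζ0
  refine (integral_zero _ _).trans ?_
  rw [← integral_indicator hS, ← hfin]
  refine integral_congr_ae (Filter.Eventually.of_forall fun ω => ?_)
  by_cases h1 : ω ∈ F ⁻¹' s <;> simp [hζ, hξ, hI, h1]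

end Causal

/-! ### Conditional mean of the corrected label -/

section Label

variable {Ω 𝒲 𝒳 : Type*} [mΩ : MeasurableSpace Ω] [MeasurableSpace 𝒲] [MeasurableSpace 𝒳]
  {P : Measure Ω} [IsProbabilityMeasure P]

/-- The error of the doubly robust label corrected by the nuisance product. -/
noncomputable def labelResidual (P : Measure Ω) (W : Ω → 𝒲) (D Y₁ Y₀ Y : Ω → ℝ)
    (h a : ℝ → 𝒲 → ℝ) : Ω → ℝ := fun ω =>
  drLabel h a (W ω, D ω, Y ω) + nuisanceProduct P W D Y h a ω - (Y₁ ω - Y₀ ω)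

/-- A positive weight, depending on the covariates, that makes the inverse propensities and the
nuisance functions bounded. -/
noncomputable def truncationWeight {Ω 𝒲 : Type*} (p : Ω → ℝ) (W : Ω → 𝒲) (h a : ℝ → 𝒲 → ℝ) :
    Ω → ℝ := fun ω =>
  1 / (1 + |1 / p ω| + |1 / (1 - p ω)| + |h 1 (W ω) / p ω| + |h 0 (W ω) / (1 - p ω)| +
    |a 1 (W ω)| + |a 0 (W ω)|)

theorem truncationWeight_pos {Ω 𝒲 : Type*} (p : Ω → ℝ) (W : Ω → 𝒲) (h a : ℝ → 𝒲 → ℝ) (ω : Ω) :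
    0 < truncationWeight p W h a ω := by
  unfold truncationWeight
  positivity

theorem abs_one_div_mul_le_one {S x : ℝ} (hS : |x| ≤ S) : |1 / S * x| ≤ 1 := by
  have h0 : 0 ≤ S := (abs_nonneg x).trans hS
  rw [abs_mul, abs_of_nonneg (one_div_nonneg.2 h0), one_div_mul_eq_div]
  exact div_le_one_of_le₀ hS h0

theorem truncationWeight_bounds {Ω 𝒲 : Type*} (p : Ω → ℝ) (W : Ω → 𝒲) (h a : ℝ → 𝒲 → ℝ) (ω : Ω) :
    |truncationWeight p W h a ω * 1| ≤ 1 ∧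
      |truncationWeight p W h a ω * (1 / p ω)| ≤ 1 ∧
      |truncationWeight p W h a ω * (1 / (1 - p ω))| ≤ 1 ∧
      |truncationWeight p W h a ω * (h 1 (W ω) / p ω)| ≤ 1 ∧
      |truncationWeight p W h a ω * (h 0 (W ω) / (1 - p ω))| ≤ 1 ∧
      |truncationWeight p W h a ω * a 1 (W ω)| ≤ 1 ∧
      |truncationWeight p W h a ω * a 0 (W ω)| ≤ 1 := by
  have n1 := abs_nonneg (1 / p ω)
  have n2 := abs_nonneg (1 / (1 - p ω))
  have n3 := abs_nonneg (h 1 (W ω) / p ω)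
  have n4 := abs_nonneg (h 0 (W ω) / (1 - p ω))
  have n5 := abs_nonneg (a 1 (W ω))
  have n6 := abs_nonneg (a 0 (W ω))
  refine ⟨?_, ?_, ?_, ?_, ?_, ?_, ?_⟩ <;> refine abs_one_div_mul_le_one ?_
  · rw [abs_one]; linarith
  all_goals linarith

theorem measurable_truncationWeight {Ω 𝒲 : Type*} [MeasurableSpace 𝒲] {m : MeasurableSpace Ω}
    {p : Ω → ℝ} {W : Ω → 𝒲}
    {h a : ℝ → 𝒲 → ℝ} (hp : Measurable[m] p) (hW : Measurable[m] W)
    (hh : ∀ d, Measurable (h d)) (ha : ∀ d, Measurable (a d)) :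
    Measurable[m] (truncationWeight p W h a) := by
  unfold truncationWeight
  have h1 : Measurable[m] fun ω => h 1 (W ω) := (hh 1).comp hW
  have h2 : Measurable[m] fun ω => h 0 (W ω) := (hh 0).comp hW
  have h3 : Measurable[m] fun ω => a 1 (W ω) := (ha 1).comp hW
  have h4 : Measurable[m] fun ω => a 0 (W ω) := (ha 0).comp hW
  fun_prop

variable {W : Ω → 𝒲} {D Y₁ Y₀ Y : Ω → ℝ} {h a : ℝ → 𝒲 → ℝ}

theorem integrable_outcome {P : Measure Ω} (hD : Measurable D) (hD01 : ∀ᵐ ω ∂P, D ω = 0 ∨ D ω = 1)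
    (hY : ∀ᵐ ω ∂P, Y ω = D ω * Y₁ ω + (1 - D ω) * Y₀ ω) (hY₁ : Integrable Y₁ P)
    (hY₀ : Integrable Y₀ P) : Integrable Y P := by
  have h1 : Integrable (fun ω => D ω * Y₁ ω) P := by
    refine hY₁.bdd_mul (c := 1) hD.aestronglyMeasurable ?_
    filter_upwards [hD01] with ω h
    rcases h with h | h <;> simp [h]
  have h2 : Integrable (fun ω => (1 - D ω) * Y₀ ω) P := by
    refine hY₀.bdd_mul (c := 1) (measurable_const.sub hD).aestronglyMeasurable ?_
    filter_upwards [hD01] with ω h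
    rcases h with h | h <;> simp [h]
  exact (h1.add h2).congr (hY.mono fun ω h => h.symm)

/-- The corrected label residual, as a sum of a regression residual and treatment residuals. -/
theorem labelResidual_eq {P : Measure Ω} {ω : Ω} {u : ℝ} (hD : D ω = 0 ∨ D ω = 1)
    (hY : Y ω = D ω * Y₁ ω + (1 - D ω) * Y₀ ω)
    (hp : 0 < propensity P W D ω ∧ propensity P W D ω < 1) :
    u * labelResidual P W D Y₁ Y₀ Y h a ω =
      u * (a (D ω) (W ω) - signedInvPropensity P W D ω) * (Y ω - outcomeReg P W D Y ω) +
        Y₁ ω * (u * (1 / propensity P W D ω) * (D ω - propensity P W D ω)) +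
        Y₀ ω * (u * (1 / (1 - propensity P W D ω)) * (D ω - propensity P W D ω)) -
        1 * ((u * (h 1 (W ω) / propensity P W D ω) +
          u * (h 0 (W ω) / (1 - propensity P W D ω))) * (D ω - propensity P W D ω)) := by
  have h1 : propensity P W D ω ≠ 0 := hp.1.ne'
  have h2 : 1 - propensity P W D ω ≠ 0 := by linarith [hp.2]
  simp only [labelResidual, drLabel, nuisanceProduct, signedInvPropensity]
  rw [hY]
  rcases hD with h0 | h0 <;> rw [h0] <;> field_simp <;> ring

/-- The residual splits into an outcome residual times a function of `(D, W)` and treatment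
residuals times functions of `W` and one potential outcome; each is orthogonal to functions of `W`.
The inverse propensities and nuisances may be unbounded, so the separate pieces need not be
integrable; the positive weight makes them so. -/
theorem setIntegral_weight_mul_labelResidual (hW : Measurable W) (hD : Measurable D)
    (hY₁m : Measurable Y₁) (hY₀m : Measurable Y₀)
    (hD01 : ∀ᵐ ω ∂P, D ω = 0 ∨ D ω = 1)
    (hY : ∀ᵐ ω ∂P, Y ω = D ω * Y₁ ω + (1 - D ω) * Y₀ ω)
    (hY₁ : Integrable Y₁ P) (hY₀ : Integrable Y₀ P)
    (hci : CondIndepGiven P (sigmaOf W) (fun ω => (Y₁ ω, Y₀ ω)) D)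
    (hp : ∀ᵐ ω ∂P, 0 < propensity P W D ω ∧ propensity P W D ω < 1)
    (hh : Measurable fun q : ℝ × 𝒲 => h q.1 q.2) (ha : Measurable fun q : ℝ × 𝒲 => a q.1 q.2)
    {A : Set Ω} (hA : MeasurableSet[sigmaOf W] A) :
    ∫ ω in A, truncationWeight (propensity P W D) W h a ω * labelResidual P W D Y₁ Y₀ Y h a ω ∂P
      = 0 := by
  have hσW : sigmaOf W ≤ mΩ := hW.comap_le
  have hWm : Measurable[sigmaOf W] W := comap_measurable W
  have hDW : Measurable fun ω => (D ω, W ω) := hD.prodMk hW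
  have hσDW : sigmaOf (fun ω => (D ω, W ω)) ≤ mΩ := hDW.comap_le
  have hDWm : Measurable[sigmaOf fun ω => (D ω, W ω)] fun ω => (D ω, W ω) := comap_measurable _
  have hWle : sigmaOf W ≤ sigmaOf (fun ω => (D ω, W ω)) :=
    (measurable_snd.comp hDWm).comap_le
  have hYi := integrable_outcome hD hD01 hY hY₁ hY₀
  have hh' : ∀ d, Measurable (h d) := fun d => hh.comp measurable_prodMk_left
  have ha' : ∀ d, Measurable (a d) := fun d => ha.comp measurable_prodMk_left
  set p := propensity P W D with hpdef
  have hpm : Measurable[sigmaOf W] p := stronglyMeasurable_condExp.measurable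
  have hwm := measurable_truncationWeight hpm hWm hh' ha'
  set w := truncationWeight p W h a with hwdef
  -- Folding the test event into the weight reduces the claim to integrals over the whole space with
  -- a multiplier that is still `W`-measurable.
  set u : Ω → ℝ := A.indicator w with hu
  have hum : Measurable[sigmaOf W] u := hwm.indicator hA
  have hub : ∀ ω (x : ℝ), |w ω * x| ≤ 1 → |u ω * x| ≤ 1 := by
    intro ω x hx
    by_cases hω : ω ∈ A
    · simpa [hu, hω] using hx
    · simp [hu, hω]
  have b := truncationWeight_bounds p W h a
  have hF : Measurable fun ω => (Y₁ ω, Y₀ ω) := hY₁m.prodMk hY₀m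
  have hFm : Measurable[sigmaOf fun ω => (Y₁ ω, Y₀ ω)] fun ω => (Y₁ ω, Y₀ ω) := comap_measurable _
  have t1 := integral_residual_mul_eq_zero hσW hF hD hD01 hci hp
    (g := fun ω => u ω * (1 / p ω)) (φ := Y₁) (c := 1)
    (hum.mul (hpm.const_div 1)).stronglyMeasurable (fun ω => hub ω _ (b ω).2.1)
    (measurable_fst.comp hFm).stronglyMeasurable hY₁
  have t0 := integral_residual_mul_eq_zero hσW hF hD hD01 hci hp
    (g := fun ω => u ω * (1 / (1 - p ω))) (φ := Y₀) (c := 1)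
    (hum.mul ((measurable_const.sub hpm).const_div 1)).stronglyMeasurable
    (fun ω => hub ω _ (b ω).2.2.1) (measurable_snd.comp hFm).stronglyMeasurable hY₀
  have tc := integral_residual_mul_eq_zero hσW hF hD hD01 hci hp
    (g := fun ω => u ω * (h 1 (W ω) / p ω) + u ω * (h 0 (W ω) / (1 - p ω))) (φ := fun _ => 1)
    (c := 1 + 1)
    ((hum.mul (((hh' 1).comp hWm).div hpm)).add
      (hum.mul (((hh' 0).comp hWm).div (measurable_const.sub hpm)))).stronglyMeasurable
    (fun ω => (abs_add_le _ _).trans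
      (add_le_add (hub ω _ (b ω).2.2.2.1) (hub ω _ (b ω).2.2.2.2.1)))
    stronglyMeasurable_const (integrable_const _)
  set a₀ := signedInvPropensity P W D with ha₀
  have hga : Measurable[sigmaOf fun ω => (D ω, W ω)]
      fun ω => u ω * (a (D ω) (W ω) - a₀ ω) := by
    have m1 : Measurable[sigmaOf fun ω => (D ω, W ω)] u := hum.mono hWle le_rfl
    have m2 : Measurable[sigmaOf fun ω => (D ω, W ω)] p := hpm.mono hWle le_rfl
    have m3 : Measurable[sigmaOf fun ω => (D ω, W ω)] fun ω => a (D ω) (W ω) := ha.comp hDWm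
    have m4 : Measurable[sigmaOf fun ω => (D ω, W ω)] D := measurable_fst.comp hDWm
    exact m1.mul (m3.sub ((m4.sub m2).div (m2.mul (measurable_const.sub m2))))
  have hgb : ∀ᵐ ω ∂P, ‖u ω * (a (D ω) (W ω) - a₀ ω)‖ ≤ 1 + 1 := by
    filter_upwards [hD01, hp] with ω h1 h2
    have e1 : p ω ≠ 0 := h2.1.ne'
    have e2 : 1 - p ω ≠ 0 := by linarith [h2.2]
    rw [Real.norm_eq_abs, mul_sub]
    refine (abs_sub _ _).trans (add_le_add ?_ ?_)
    · rcases h1 with h1 | h1 <;> rw [h1]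
      · exact hub ω _ (b ω).2.2.2.2.2.2
      · exact hub ω _ (b ω).2.2.2.2.2.1
    · rcases h1 with h1 | h1
      · have : a₀ ω = -(1 / (1 - p ω)) := by
          simp only [ha₀, signedInvPropensity, ← hpdef, h1]
          field_simp
          ring
        rw [this, mul_neg, abs_neg]
        exact hub ω _ (b ω).2.2.1
      · have : a₀ ω = 1 / p ω := by
          simp only [ha₀, signedInvPropensity, ← hpdef, h1]
          field_simp
        rw [this]
        exact hub ω _ (b ω).2.1
  have hres : Integrable (Y - outcomeReg P W D Y) P := hYi.sub integrable_condExp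
  have ti : Integrable (fun ω => u ω * (a (D ω) (W ω) - a₀ ω) *
      (Y ω - outcomeReg P W D Y ω)) P :=
    hres.bdd_mul (hga.mono hσDW le_rfl).aestronglyMeasurable hgb
  have ta : ∫ ω, u ω * (a (D ω) (W ω) - a₀ ω) * (Y ω - outcomeReg P W D Y ω) ∂P = 0 :=
    integral_mul_eq_zero_of_condExp hσDW hga.stronglyMeasurable hres ti
      (condExp_sub_condExp hσDW hYi)
  have hu' : ∀ ω, A.indicator (fun ω => w ω * labelResidual P W D Y₁ Y₀ Y h a ω) ω =
      u ω * labelResidual P W D Y₁ Y₀ Y h a ω := by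
    intro ω
    by_cases hω : ω ∈ A <;> simp [hu, hω]
  rw [← integral_indicator (hσW _ hA)]
  simp only [hu']
  have hcongr : (fun ω => u ω * labelResidual P W D Y₁ Y₀ Y h a ω) =ᵐ[P] fun ω =>
      u ω * (a (D ω) (W ω) - a₀ ω) * (Y ω - outcomeReg P W D Y ω) +
        Y₁ ω * (u ω * (1 / p ω) * (D ω - p ω)) +
        Y₀ ω * (u ω * (1 / (1 - p ω)) * (D ω - p ω)) -
        1 * ((u ω * (h 1 (W ω) / p ω) + u ω * (h 0 (W ω) / (1 - p ω))) * (D ω - p ω)) := by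
    filter_upwards [hD01, hY, hp] with ω h1 h2 h3
    exact labelResidual_eq (u := u ω) h1 h2 h3
  rw [integral_congr_ae hcongr]
  have s1 := ti.add t1.1
  have s2 := s1.add t0.1
  have g1 := integral_add ti t1.1
  have g2 := integral_add s1 t0.1
  have g3 := integral_sub s2 tc.1
  simp only [Pi.add_apply] at g2 g3
  refine g3.trans ?_
  rw [g2, g1, ta, t1.2, t0.2, tc.2]
  norm_num

/-- The weight pulls out of the conditional expectation given `W` and, being strictly positive, can
be cancelled. -/
theorem condExp_labelResidual (hW : Measurable W) (hD : Measurable D)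
    (hY₁m : Measurable Y₁) (hY₀m : Measurable Y₀)
    (hD01 : ∀ᵐ ω ∂P, D ω = 0 ∨ D ω = 1)
    (hY : ∀ᵐ ω ∂P, Y ω = D ω * Y₁ ω + (1 - D ω) * Y₀ ω)
    (hY₁ : Integrable Y₁ P) (hY₀ : Integrable Y₀ P)
    (hci : CondIndepGiven P (sigmaOf W) (fun ω => (Y₁ ω, Y₀ ω)) D)
    (hp : ∀ᵐ ω ∂P, 0 < propensity P W D ω ∧ propensity P W D ω < 1)
    (hh : Measurable fun q : ℝ × 𝒲 => h q.1 q.2) (ha : Measurable fun q : ℝ × 𝒲 => a q.1 q.2)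
    (hR : Integrable (labelResidual P W D Y₁ Y₀ Y h a) P) :
    P[labelResidual P W D Y₁ Y₀ Y h a | sigmaOf W] =ᵐ[P] 0 := by
  have hσW : sigmaOf W ≤ mΩ := hW.comap_le
  have hwm : Measurable[sigmaOf W] (truncationWeight (propensity P W D) W h a) :=
    measurable_truncationWeight stronglyMeasurable_condExp.measurable (comap_measurable W)
      (fun d => hh.comp measurable_prodMk_left) (fun d => ha.comp measurable_prodMk_left)
  set w := truncationWeight (propensity P W D) W h a with hw
  have hwb : ∀ ω, ‖w ω‖ ≤ 1 := fun ω => by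
    have := (truncationWeight_bounds (propensity P W D) W h a ω).1
    rwa [mul_one] at this
  have hwR : Integrable (w * labelResidual P W D Y₁ Y₀ Y h a) P :=
    hR.bdd_mul (hwm.mono hσW le_rfl).aestronglyMeasurable (Filter.Eventually.of_forall hwb)
  have h0 : 0 =ᵐ[P] P[w * labelResidual P W D Y₁ Y₀ Y h a | sigmaOf W] := by
    refine ae_eq_condExp_of_forall_setIntegral_eq hσW hwR (fun _ _ _ => integrableOn_zero)
      ?_ aestronglyMeasurable_zero
    intro A hA _
    refine (integral_zero _ _).trans ?_
    exact (setIntegral_weight_mul_labelResidual hW hD hY₁m hY₀m hD01 hY hY₁ hY₀ hci hp hh ha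
      hA).symm
  filter_upwards [h0, condExp_mul_of_stronglyMeasurable_left hwm.stronglyMeasurable hwR hR]
    with ω h1 h2
  rw [← h1, Pi.zero_apply, Pi.mul_apply] at h2
  exact (mul_eq_zero.1 h2.symm).resolve_left (truncationWeight_pos _ _ _ _ _).ne'

/-- The doubly robust label estimates the treatment effect with bias `-𝔼[q | X]`. -/
theorem condExp_drLabel {proj : 𝒲 → 𝒳} (hproj : Measurable proj) (hW : Measurable W)
    (hD : Measurable D) (hY₁m : Measurable Y₁) (hY₀m : Measurable Y₀)
    (hD01 : ∀ᵐ ω ∂P, D ω = 0 ∨ D ω = 1)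
    (hY : ∀ᵐ ω ∂P, Y ω = D ω * Y₁ ω + (1 - D ω) * Y₀ ω)
    (hY₁ : Integrable Y₁ P) (hY₀ : Integrable Y₀ P)
    (hci : CondIndepGiven P (sigmaOf W) (fun ω => (Y₁ ω, Y₀ ω)) D)
    (hp : ∀ᵐ ω ∂P, 0 < propensity P W D ω ∧ propensity P W D ω < 1)
    (hh : Measurable fun q : ℝ × 𝒲 => h q.1 q.2) (ha : Measurable fun q : ℝ × 𝒲 => a q.1 q.2)
    (hψ : Integrable (fun ω => drLabel h a (W ω, D ω, Y ω)) P)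
    (hq : Integrable (nuisanceProduct P W D Y h a) P) :
    ∀ᵐ ω ∂P, (P[fun ω => drLabel h a (W ω, D ω, Y ω) | sigmaOf fun ω => proj (W ω)]) ω =
      cate P (fun ω => proj (W ω)) Y₁ Y₀ ω -
        (P[nuisanceProduct P W D Y h a | sigmaOf fun ω => proj (W ω)]) ω := by
  have hσW : sigmaOf W ≤ mΩ := hW.comap_le
  have hle : sigmaOf (fun ω => proj (W ω)) ≤ sigmaOf W :=
    (hproj.comp (comap_measurable W)).comap_le
  have hY10 : Integrable (fun ω => Y₁ ω - Y₀ ω) P := hY₁.sub hY₀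
  have hsum := hψ.add hq
  have hR : Integrable (labelResidual P W D Y₁ Y₀ Y h a) P := hsum.sub hY10
  have h1 := condExp_condExp_of_le (f := labelResidual P W D Y₁ Y₀ Y h a) (μ := P) hle hσW
  have h2 := condExp_congr_ae (m := sigmaOf fun ω => proj (W ω))
    (condExp_labelResidual hW hD hY₁m hY₀m hD01 hY hY₁ hY₀ hci hp hh ha hR)
  have h3 := condExp_sub hsum hY10 (sigmaOf fun ω => proj (W ω))
  have h4 := condExp_add hψ hq (sigmaOf fun ω => proj (W ω))
  rw [condExp_zero] at h2
  filter_upwards [h1, h2, h3, h4] with ω h1 h2 h3 h4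
  have h5 : (P[labelResidual P W D Y₁ Y₀ Y h a | sigmaOf fun ω => proj (W ω)]) ω = 0 := by
    rw [← h1, h2, Pi.zero_apply]
  have h6 := h3.symm.trans h5
  rw [Pi.sub_apply, h4, Pi.add_apply] at h6
  unfold cate
  linarith

end Label

/-! ### Risk comparison and the oracle inequality -/

section Risk

variable {Ω 𝒲 𝒳 : Type*} {m : MeasurableSpace Ω} [mΩ : MeasurableSpace Ω] [MeasurableSpace 𝒲] [MeasurableSpace 𝒳]
  {P : Measure Ω} [IsProbabilityMeasure P]

/-- If the label `ψ` estimates `τ` given `m` with square integrable bias `-e`, then excess risks for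
the label control excess squared distances to `τ`. -/
theorem integral_sub_sq_le_of_condExp (hm : m ≤ mΩ)
    {ψ τ e F H : Ω → ℝ} {U : ℝ} (hψm : AEStronglyMeasurable ψ P) (hψb : ∀ᵐ ω ∂P, |ψ ω| ≤ U)
    (hτ : MemLp τ 2 P) (he : ∀ᵐ ω ∂P, (P[ψ | m]) ω = τ ω - e ω)
    (hF : Measurable[m] F) (hH : Measurable[m] H) (hFb : ∀ᵐ ω ∂P, |F ω| ≤ U)
    (hHb : ∀ᵐ ω ∂P, |H ω| ≤ U) :
    ∫ ω, (F ω - τ ω) ^ 2 ∂P ≤ (∫ ω, (H ω - τ ω) ^ 2 ∂P) +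
      ((∫ ω, (ψ ω - F ω) ^ 2 ∂P) + 1 / 56 * (∫ ω, (F ω - H ω) ^ 2 ∂P) -
        ∫ ω, (ψ ω - H ω) ^ 2 ∂P) + 56 * ∫ ω, e ω ^ 2 ∂P := by
  have hFm : Measurable F := hF.mono hm le_rfl
  have hHm : Measurable H := hH.mono hm le_rfl
  have hψL : MemLp ψ 2 P := MemLp.of_bound hψm U hψb
  have hFL : MemLp F 2 P := MemLp.of_bound hFm.aestronglyMeasurable U hFb
  have hHL : MemLp H 2 P := MemLp.of_bound hHm.aestronglyMeasurable U hHb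
  have hψi : Integrable ψ P := hψL.integrable (by norm_num)
  -- The bias is the difference of `τ` and `E[ψ | m]`, both square integrable, so no moment
  -- condition on it is needed.
  have heL : MemLp e 2 P := by
    have h1 : MemLp (τ - P[ψ | m]) 2 P := hτ.sub (hψL.condExp (by norm_num))
    refine h1.ae_eq ?_
    filter_upwards [he] with ω h
    rw [Pi.sub_apply, h]
    ring
  have i1 := (hFL.sub hτ).integrable_sq
  have i2 := (hHL.sub hτ).integrable_sq
  have i3 := (hψL.sub hFL).integrable_sq
  have i4 := (hFL.sub hHL).integrable_sq
  have i5 := (hψL.sub hHL).integrable_sq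
  have i6 := heL.integrable_sq
  simp only [Pi.sub_apply] at i1 i2 i3 i4 i5 i6
  have hres : Integrable (ψ - P[ψ | m]) P := hψi.sub integrable_condExp
  have hFH : ∀ᵐ ω ∂P, ‖(F - H) ω‖ ≤ U + U := by
    filter_upwards [hFb, hHb] with ω h1 h2
    exact (abs_sub _ _).trans (add_le_add h1 h2)
  have i7 : Integrable ((F - H) * (ψ - P[ψ | m])) P :=
    hres.bdd_mul (hFm.sub hHm).aestronglyMeasurable hFH
  have h7 := integral_mul_eq_zero_of_condExp hm (hF.sub hH).stronglyMeasurable hres i7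
    (condExp_sub_condExp hm hψi)
  have i8 : Integrable (fun ω => (F - H) ω * (ψ - P[ψ | m]) ω) P := i7
  have j1 := i3.add (i4.const_mul (1 / 56))
  have j2 := j1.sub i5
  have j3 := i2.add j2
  have j4 := j3.add (i6.const_mul 56)
  have j5 := j4.add (i8.const_mul 2)
  -- Pointwise, the change of reference from `ψ` to `τ` contributes `2 (F - H) (ψ - E[ψ | m]) - 2 (F
  -- - H) e`. The first term integrates to zero; Young's inequality with parameter `56` bounds the
  -- second, matching the gain `1/56`.
  have hle : ∫ ω, (F ω - τ ω) ^ 2 ∂P ≤ _ := integral_mono_ae i1 j5 (by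
    filter_upwards [he] with ω h
    simp only [Pi.add_apply, Pi.sub_apply, h]
    nlinarith [sq_nonneg ((F ω - H ω) + 56 * e ω)])
  have k1 := integral_add i3 (i4.const_mul (1 / 56))
  have k2 := integral_sub j1 i5
  have k3 := integral_add i2 j2
  have k4 := integral_add j3 (i6.const_mul 56)
  have k5 := integral_add j4 (i8.const_mul 2)
  rw [integral_const_mul] at k1 k4 k5
  rw [h7] at k5
  simp only [Pi.add_apply, Pi.sub_apply] at hle k1 k2 k3 k4 k5
  linarith

theorem measurable_drLabel {h a : ℝ → 𝒲 → ℝ} (hh : Measurable fun q : ℝ × 𝒲 => h q.1 q.2)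
    (ha : Measurable fun q : ℝ × 𝒲 => a q.1 q.2) : Measurable (drLabel h a) := by
  have h1 : ∀ d, Measurable (h d) := fun d => hh.comp measurable_prodMk_left
  have h2 : Measurable fun z : 𝒲 × ℝ × ℝ => h z.2.1 z.1 :=
    hh.comp (measurable_snd.fst.prodMk measurable_fst)
  have h3 : Measurable fun z : 𝒲 × ℝ × ℝ => a z.2.1 z.1 :=
    ha.comp (measurable_snd.fst.prodMk measurable_fst)
  exact (((h1 1).comp measurable_fst).sub ((h1 0).comp measurable_fst)).add
    (h3.mul (measurable_snd.snd.sub h2))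

/-- The oracle inequality for fixed models and nuisance functions, on the deviation event. -/
theorem sqDist_ensemble_le_of_deviation {M n : ℕ} (hn : 1 ≤ n) {U : ℝ} (hU : 0 < U)
    {W : Ω → 𝒲} {proj : 𝒲 → 𝒳} {D Y₁ Y₀ Y : Ω → ℝ} (hW : Measurable W)
    (hproj : Measurable proj) (hD : Measurable D) (hY₁m : Measurable Y₁) (hY₀m : Measurable Y₀)
    (hYm : Measurable Y) (hD01 : ∀ᵐ ω ∂P, D ω = 0 ∨ D ω = 1)
    (hY : ∀ᵐ ω ∂P, Y ω = D ω * Y₁ ω + (1 - D ω) * Y₀ ω)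
    (hY₁ : Integrable Y₁ P) (hY₀ : Integrable Y₀ P)
    (hτ : MemLp (cate P (fun ω => proj (W ω)) Y₁ Y₀) 2 P)
    (hci : CondIndepGiven P (sigmaOf W) (fun ω => (Y₁ ω, Y₀ ω)) D)
    (hp : ∀ᵐ ω ∂P, 0 < propensity P W D ω ∧ propensity P W D ω < 1)
    {f : Fin M → 𝒳 → ℝ} {h a : ℝ → 𝒲 → ℝ} (hf : ∀ j, Measurable (f j))
    (hh : Measurable fun q : ℝ × 𝒲 => h q.1 q.2) (ha : Measurable fun q : ℝ × 𝒲 => a q.1 q.2)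
    (hq : Integrable (nuisanceProduct P W D Y h a) P)
    (hψb : ∀ᵐ ω ∂P, |drLabel h a (W ω, D ω, Y ω)| ≤ U)
    (hfb : ∀ j, ∀ᵐ ω ∂P, |f j (proj (W ω))| ≤ U)
    {β L : ℝ} (hβ : 112 * U ^ 2 ≤ β) {prior : Fin M → ℝ} (hπ : ∀ j, 0 < prior j)
    (hπ1 : ∑ j, prior j = 1) {z : Fin n → 𝒲 × ℝ × ℝ} {θ : Fin M → ℝ}
    (hθ : IsQAggregate (1 / 2) β prior proj h a f z θ) (J : Fin M)
    (hdev : ∀ j k, ∑ i, 1 / (56 * U ^ 2) *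
        ((∫ y, pairExcess (drLabel h a y) (f J (proj y.1)) (f j (proj y.1)) (f k (proj y.1))
            ∂(P.map fun ω => (W ω, D ω, Y ω))) -
          pairExcess (drLabel h a (z i)) (f J (proj (z i).1)) (f j (proj (z i).1))
            (f k (proj (z i).1))) ≤
      n * (3 / 4 * (1 / (56 * U ^ 2)) ^ 2 *
        ∫ y, pairExcess (drLabel h a y) (f J (proj y.1)) (f j (proj y.1)) (f k (proj y.1)) ^ 2
          ∂(P.map fun ω => (W ω, D ω, Y ω))) +
        Real.log (1 / (prior j * prior k)) + L) :
    sqDist P (fun ω => proj (W ω)) (ensemble f θ) (cate P (fun ω => proj (W ω)) Y₁ Y₀) ≤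
      sqDist P (fun ω => proj (W ω)) (f J) (cate P (fun ω => proj (W ω)) Y₁ Y₀) +
        β / n * Real.log (1 / prior J) + 56 * U ^ 2 / n * L +
        14 * nuisanceError P (fun ω => proj (W ω)) W D Y h a ^ 2 := by
  have hV : Measurable fun ω => (W ω, D ω, Y ω) := hW.prodMk (hD.prodMk hYm)
  have hμ : IsProbabilityMeasure (P.map fun ω => (W ω, D ω, Y ω)) :=
    Measure.isProbabilityMeasure_map hV.aemeasurable
  have hψ := measurable_drLabel hh ha
  have hx : ∀ j, Measurable fun y : 𝒲 × ℝ × ℝ => f j (proj y.1) := fun j =>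
    (hf j).comp (hproj.comp measurable_fst)
  have hψb' : ∀ᵐ y ∂(P.map fun ω => (W ω, D ω, Y ω)), |drLabel h a y| ≤ U :=
    (ae_map_iff hV.aemeasurable (measurableSet_le hψ.abs measurable_const)).2 hψb
  have hxb' : ∀ j, ∀ᵐ y ∂(P.map fun ω => (W ω, D ω, Y ω)), |f j (proj y.1)| ≤ U := fun j =>
    (ae_map_iff hV.aemeasurable (measurableSet_le (hx j).abs measurable_const)).2 (hfb j)
  have hπle : ∀ j, prior j ≤ 1 := fun j =>
    hπ1 ▸ Finset.single_le_sum (fun k _ => (hπ k).le) (Finset.mem_univ j)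
  have hexc := excess_le_of_deviation hn hU hθ.1.1 hθ.1.2 hπ hπle hβ hψ (hx J) hx hψb' (hxb' J)
    hxb' hdev (hθ.sum_pairExcess_le J)
  have hens : Measurable fun y : 𝒲 × ℝ × ℝ => ∑ j, θ j * f j (proj y.1) := by fun_prop
  have hF : Measurable[sigmaOf fun ω => proj (W ω)] fun ω => ensemble f θ (proj (W ω)) := by
    have : Measurable (ensemble f θ) := by unfold ensemble; fun_prop
    exact this.comp (comap_measurable fun ω => proj (W ω))
  have hFb : ∀ᵐ ω ∂P, |ensemble f θ (proj (W ω))| ≤ U := by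
    filter_upwards [ae_all_iff.2 hfb] with ω hω
    exact abs_sum_mul_le hθ.1.1 hθ.1.2 hω
  have hψ' : AEStronglyMeasurable (fun ω => drLabel h a (W ω, D ω, Y ω)) P :=
    (hψ.comp hV).aestronglyMeasurable
  have hbias := condExp_drLabel hproj hW hD hY₁m hY₀m hD01 hY hY₁ hY₀ hci hp hh ha
    (integrable_of_abs_le hψ' hψb) hq
  have hcmp := integral_sub_sq_le_of_condExp (hproj.comp hW).comap_le hψ' hψb hτ hbias hF
    ((hf J).comp (comap_measurable fun ω => proj (W ω))) hFb (hfb J)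
  have hmap : ∀ {u v : 𝒲 × ℝ × ℝ → ℝ}, Measurable u → Measurable v →
      ∫ y, (u y - v y) ^ 2 ∂(P.map fun ω => (W ω, D ω, Y ω)) =
        ∫ ω, (u (W ω, D ω, Y ω) - v (W ω, D ω, Y ω)) ^ 2 ∂P := fun hu hv =>
    integral_map hV.aemeasurable ((hu.sub hv).pow_const 2).aestronglyMeasurable
  rw [hmap hψ hens, hmap hens (hx J), hmap hψ (hx J)] at hexc
  -- The factor `2` in `nuisanceError` becomes `4` on squaring, so `56 E[e²]` is `14` times the
  -- squared error.
  have herr : nuisanceError P (fun ω => proj (W ω)) W D Y h a ^ 2 =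
      4 * ∫ ω, ((P[nuisanceProduct P W D Y h a | sigmaOf fun ω => proj (W ω)]) ω) ^ 2 ∂P := by
    rw [nuisanceError, mul_pow, Real.sq_sqrt (integral_nonneg fun _ => sq_nonneg _)]
    norm_num
  rw [herr]
  unfold sqDist
  simp only [ensemble, Function.comp_apply] at hcmp hexc ⊢
  linarith

/-- The oracle index depends on the training data, and the deviation bound needs functions
measurable in them. Taking the least minimizing index gives a measurable choice. -/
theorem exists_measurable_argmin {𝒯 : Type*} [MeasurableSpace 𝒯] {M : ℕ} (hM : 1 ≤ M)
    {v : 𝒯 → Fin M → ℝ} (hv : ∀ j, Measurable fun t => v t j) :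
    ∃ J : 𝒯 → Fin M, Measurable J ∧ ∀ t j, v t (J t) ≤ v t j := by
  classical
  have : Nonempty (Fin M) := ⟨⟨0, hM⟩⟩
  have hex : ∀ t, ∃ k : ℕ, ∃ hk : k < M, ∀ j, v t ⟨k, hk⟩ ≤ v t j := fun t => by
    obtain ⟨j, hj⟩ := Finite.exists_min (v t)
    exact ⟨j, j.2, hj⟩
  refine ⟨fun t => ⟨Nat.find (hex t), (Nat.find_spec (hex t)).1⟩, ?_,
    fun t => (Nat.find_spec (hex t)).2⟩
  have hfind := measurable_find hex fun k => by
    by_cases hk : k < M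
    · simp only [hk, exists_true_left]
      have : {t | ∀ j, v t ⟨k, hk⟩ ≤ v t j} = ⋂ j, {t | v t ⟨k, hk⟩ ≤ v t j} := by
        ext t; simp
      rw [this]
      exact MeasurableSet.iInter fun j => measurableSet_le (hv _) (hv j)
    · simp [hk]
  refine measurable_to_countable' fun j => ?_
  convert hfind (measurableSet_singleton (j : ℕ)) using 1
  ext t
  simp [Fin.ext_iff]

end Risk

/-! ### The oracle inequality for random training data -/

section Oracle

variable {Ω 𝒲 𝒳 Ω' 𝒯 : Type*} [MeasurableSpace Ω] [MeasurableSpace 𝒲] [MeasurableSpace 𝒳]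
  [MeasurableSpace Ω'] [MeasurableSpace 𝒯] {P : Measure Ω} [IsProbabilityMeasure P]
  {P' : Measure Ω'} [IsProbabilityMeasure P']

theorem sqDist_eq_of_ae_zero {𝒳 : Type*} {P : Measure Ω} {X : Ω → 𝒳} {g : 𝒳 → ℝ} {τ : Ω → ℝ} (hg : ∀ᵐ ω ∂P, g (X ω) = 0) :
    sqDist P X g τ = ∫ ω, τ ω ^ 2 ∂P := by
  refine integral_congr_ae ?_
  filter_upwards [hg] with ω h
  simp [h]

/-- The oracle inequality when all models vanish. -/
theorem sqDist_ensemble_le_of_zero {𝒳 : Type*} {P : Measure Ω} {M : ℕ} (hM : 1 ≤ M) {X : Ω → 𝒳} {f : Fin M → 𝒳 → ℝ}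
    {τ : Ω → ℝ} (hf : ∀ j, ∀ᵐ ω ∂P, |f j (X ω)| ≤ 0) (θ : Fin M → ℝ) {c : Fin M → ℝ}
    (hc : ∀ j, 0 ≤ c j) :
    sqDist P X (ensemble f θ) τ ≤ ⨅ j, (sqDist P X (f j) τ + c j) := by
  have : Nonempty (Fin M) := ⟨⟨0, hM⟩⟩
  have hf' : ∀ j, ∀ᵐ ω ∂P, f j (X ω) = 0 := fun j => (hf j).mono fun ω h => abs_nonpos_iff.1 h
  refine le_ciInf fun j => ?_
  rw [sqDist_eq_of_ae_zero (hf' j), sqDist_eq_of_ae_zero]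
  · linarith [hc j]
  · filter_upwards [ae_all_iff.2 hf'] with ω h
    simp [ensemble, h]

/-- The oracle inequality with explicit constants. -/
theorem measure_oracle_inequality_le {U : ℝ} (hU : 0 ≤ U)
    {W : Ω → 𝒲} {proj : 𝒲 → 𝒳} {D Y₁ Y₀ Y : Ω → ℝ} (hW : Measurable W)
    (hproj : Measurable proj) (hD : Measurable D) (hY₁m : Measurable Y₁) (hY₀m : Measurable Y₀)
    (hYm : Measurable Y) (hD01 : ∀ᵐ ω ∂P, D ω = 0 ∨ D ω = 1)
    (hY : ∀ᵐ ω ∂P, Y ω = D ω * Y₁ ω + (1 - D ω) * Y₀ ω)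
    (hY₁ : Integrable Y₁ P) (hY₀ : Integrable Y₀ P)
    (hτ : MemLp (cate P (fun ω => proj (W ω)) Y₁ Y₀) 2 P)
    (hci : CondIndepGiven P (sigmaOf W) (fun ω => (Y₁ ω, Y₀ ω)) D)
    (hp : ∀ᵐ ω ∂P, 0 < propensity P W D ω ∧ propensity P W D ω < 1)
    {n M : ℕ} (hn : 1 ≤ n) (hM : 1 ≤ M) {Z : Fin n → Ω' → 𝒲 × ℝ × ℝ} {T : Ω' → 𝒯}
    (hZ : iIndepFun Z P') (hid : ∀ i, IdentDistrib (Z i) (fun ω => (W ω, D ω, Y ω)) P' P)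
    (hT : Measurable T) (hTZ : IndepFun T (fun ω i => Z i ω) P')
    {f : 𝒯 → Fin M → 𝒳 → ℝ} {h a : 𝒯 → ℝ → 𝒲 → ℝ}
    (hf : ∀ j, Measurable (fun p : 𝒯 × 𝒳 => f p.1 j p.2))
    (hh : Measurable (fun p : 𝒯 × ℝ × 𝒲 => h p.1 p.2.1 p.2.2))
    (ha : Measurable (fun p : 𝒯 × ℝ × 𝒲 => a p.1 p.2.1 p.2.2))
    (hq : ∀ᵐ t ∂(P'.map T), Integrable (nuisanceProduct P W D Y (h t) (a t)) P)
    (hψb : ∀ᵐ t ∂(P'.map T), ∀ᵐ ω ∂P, |drLabel (h t) (a t) (W ω, D ω, Y ω)| ≤ U)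
    (hfb : ∀ᵐ t ∂(P'.map T), ∀ j, ∀ᵐ ω ∂P, |f t j (proj (W ω))| ≤ U)
    {δ : ℝ} (hδ : 0 < δ) (hδ1 : δ < 1) {prior : Fin M → ℝ} (hπ : ∀ j, 0 < prior j)
    (hπ1 : ∑ j, prior j = 1) {β : ℝ} (hβ : 112 * U ^ 2 ≤ β) {θhat : Ω' → Fin M → ℝ}
    (hθ : ∀ᵐ ω ∂P', IsQAggregate (1 / 2) β prior proj (h (T ω)) (a (T ω)) (f (T ω))
      (fun i => Z i ω) (θhat ω)) :
    P' {ω | ¬ (sqDist P (fun ω' => proj (W ω')) (ensemble (f (T ω)) (θhat ω))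
          (cate P (fun ω' => proj (W ω')) Y₁ Y₀) ≤
        (⨅ j, (sqDist P (fun ω' => proj (W ω')) (f (T ω) j)
          (cate P (fun ω' => proj (W ω')) Y₁ Y₀) + β / n * Real.log (1 / prior j))) +
        (56 * U ^ 2 / n * Real.log (1 / δ) +
          14 * nuisanceError P (fun ω' => proj (W ω')) W D Y (h (T ω)) (a (T ω)) ^ 2))} ≤
      ENNReal.ofReal δ := by
  have hne : Nonempty (Fin M) := ⟨⟨0, hM⟩⟩
  have hn0 : (0 : ℝ) < n := by exact_mod_cast hn
  have hπle : ∀ j, prior j ≤ 1 := fun j =>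
    hπ1 ▸ Finset.single_le_sum (fun k _ => (hπ k).le) (Finset.mem_univ j)
  have hL : 0 ≤ Real.log (1 / δ) := Real.log_nonneg ((one_le_div hδ).2 hδ1.le)
  have hq' := ae_of_ae_map hT.aemeasurable hq
  have hψb' := ae_of_ae_map hT.aemeasurable hψb
  have hfb' := ae_of_ae_map hT.aemeasurable hfb
  -- For `U = 0` the scale `1 / (56 U²)` is meaningless, but then all models and ensembles vanish
  -- almost surely and have the same distance to `τ₀`.
  rcases hU.eq_or_lt with rfl | hU0
  · refine le_of_eq_of_le (ae_iff.1 ?_) zero_le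
    filter_upwards [hfb'] with ω hω
    have hβ0 : 0 ≤ β := by simpa using hβ
    have h1 := sqDist_ensemble_le_of_zero hM (τ := cate P (fun ω' => proj (W ω')) Y₁ Y₀) hω
      (θhat ω) (c := fun j => β / n * Real.log (1 / prior j)) fun j =>
        mul_nonneg (by positivity) (Real.log_nonneg ((one_le_div (hπ j)).2 (hπle j)))
    refine h1.trans (le_add_of_nonneg_right ?_)
    positivity
  have hV : Measurable fun ω => (W ω, D ω, Y ω) := hW.prodMk (hD.prodMk hYm)
  have hμ : IsProbabilityMeasure (P.map fun ω => (W ω, D ω, Y ω)) :=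
    Measure.isProbabilityMeasure_map hV.aemeasurable
  have hτm : Measurable (cate P (fun ω => proj (W ω)) Y₁ Y₀) :=
    (stronglyMeasurable_condExp.mono (hproj.comp hW).comap_le).measurable
  have hv : ∀ j, Measurable fun t => sqDist P (fun ω' => proj (W ω')) (f t j)
      (cate P (fun ω' => proj (W ω')) Y₁ Y₀) + β / n * Real.log (1 / prior j) := fun j => by
    have h1 : Measurable fun q : 𝒯 × Ω =>
        (f q.1 j (proj (W q.2)) - cate P (fun ω' => proj (W ω')) Y₁ Y₀ q.2) ^ 2 :=
      (((hf j).comp (measurable_fst.prodMk ((hproj.comp hW).comp measurable_snd))).sub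
        (hτm.comp measurable_snd)).pow_const 2
    exact (h1.stronglyMeasurable.integral_prod_right' (ν := P)).measurable.add_const _
  -- Fixing the reference as a function of the training data alone restricts the union bound to
  -- pairs `(j, k)`, with no extra cost for the oracle index.
  obtain ⟨J, hJ, hJmin⟩ := exists_measurable_argmin hM hv
  have hft : ∀ t j, Measurable (f t j) := fun t j => (hf j).comp measurable_prodMk_left
  have hft' : ∀ t j, Measurable fun z : 𝒲 × ℝ × ℝ => f t j (proj z.1) := fun t j =>
    (hft t j).comp (hproj.comp measurable_fst)
  have hht : ∀ t, Measurable fun q : ℝ × 𝒲 => h t q.1 q.2 := fun t =>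
    hh.comp measurable_prodMk_left
  have hat : ∀ t, Measurable fun q : ℝ × 𝒲 => a t q.1 q.2 := fun t =>
    ha.comp measurable_prodMk_left
  have hfz : ∀ j, Measurable fun q : 𝒯 × 𝒲 × ℝ × ℝ => f q.1 j (proj q.2.1) := fun j =>
    (hf j).comp (measurable_fst.prodMk (hproj.comp measurable_snd.fst))
  have hfJ : Measurable fun q : 𝒯 × 𝒲 × ℝ × ℝ => f q.1 (J q.1) (proj q.2.1) := by
    have h1 : Measurable fun q : (𝒯 × 𝒲 × ℝ × ℝ) × Fin M => f q.1.1 q.2 (proj q.1.2.1) :=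
      measurable_from_prod_countable_left fun j => hfz j
    exact h1.comp (measurable_id.prodMk (hJ.comp measurable_fst))
  have hψz : Measurable fun q : 𝒯 × 𝒲 × ℝ × ℝ => drLabel (h q.1) (a q.1) q.2 := by
    have h1 : ∀ d : ℝ, Measurable fun q : 𝒯 × 𝒲 × ℝ × ℝ => h q.1 d q.2.1 := fun d =>
      hh.comp (measurable_fst.prodMk (measurable_const.prodMk measurable_snd.fst))
    have h2 : Measurable fun q : 𝒯 × 𝒲 × ℝ × ℝ => h q.1 q.2.2.1 q.2.1 :=
      hh.comp (measurable_fst.prodMk (measurable_snd.snd.fst.prodMk measurable_snd.fst))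
    have h3 : Measurable fun q : 𝒯 × 𝒲 × ℝ × ℝ => a q.1 q.2.2.1 q.2.1 :=
      ha.comp (measurable_fst.prodMk (measurable_snd.snd.fst.prodMk measurable_snd.fst))
    exact ((h1 1).sub (h1 0)).add (h3.mul (measurable_snd.snd.snd.sub h2))
  have hB : ∀ᵐ t ∂(P'.map T), ∀ k : Fin M × Fin M, ∀ᵐ z ∂(P.map fun ω => (W ω, D ω, Y ω)),
      |pairExcess (drLabel (h t) (a t) z) (f t (J t) (proj z.1)) (f t k.1 (proj z.1))
        (f t k.2 (proj z.1))| ≤ 12 * U ^ 2 := by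
    filter_upwards [hψb, hfb] with t h1 h2 k
    have hm : Measurable fun z : 𝒲 × ℝ × ℝ => pairExcess (drLabel (h t) (a t) z)
        (f t (J t) (proj z.1)) (f t k.1 (proj z.1)) (f t k.2 (proj z.1)) :=
      measurable_pairExcess (measurable_drLabel (hht t) (hat t)) (hft' t _) (hft' t _) (hft' t _)
    rw [ae_map_iff hV.aemeasurable (measurableSet_le hm.abs measurable_const)]
    filter_upwards [h1, h2 (J t), h2 k.1, h2 k.2] with ω g1 g2 g3 g4
    exact abs_pairExcess_le g1 g2 g3 g4
  have hw1 : ∑ k : Fin M × Fin M, prior k.1 * prior k.2 ≤ 1 := by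
    rw [Fintype.sum_prod_type]
    simp only [← Finset.mul_sum, hπ1, mul_one, le_refl]
  have hmain := measure_exists_deviation_le (κ := Fin M × Fin M)
    (P.map fun ω => (W ω, D ω, Y ω)) hZ (fun i => (hid i).aemeasurable_fst)
    (fun i => (hid i).map_eq) hT hTZ (c := 1 / (56 * U ^ 2)) (B := 12 * U ^ 2)
    (w := fun k => prior k.1 * prior k.2)
    (G := fun t k z => pairExcess (drLabel (h t) (a t) z) (f t (J t) (proj z.1))
      (f t k.1 (proj z.1)) (f t k.2 (proj z.1)))
    (fun k => measurable_pairExcess hψz hfJ (hfz k.1) (hfz k.2)) hB (by positivity)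
    (by field_simp; norm_num) (fun k => mul_pos (hπ k.1) (hπ k.2)) hw1 hδ
  -- The deviation event does not involve `θhat`. The failure set is contained in its complement up
  -- to a null set, so no measurability of `θhat` is required.
  refine le_trans (measure_mono_ae ?_) hmain
  filter_upwards [hθ, hq', hψb', hfb'] with ω g1 g2 g3 g4 hbad hdev
  refine hbad ?_
  have hres := sqDist_ensemble_le_of_deviation hn hU0 hW hproj hD hY₁m hY₀m hYm hD01 hY hY₁ hY₀ hτ
    hci hp (hft (T ω)) (hht (T ω)) (hat (T ω)) g2 g3 g4 hβ hπ hπ1 g1 (J (T ω))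
    (L := Real.log (1 / δ)) fun j k => hdev (j, k)
  have hinf := le_ciInf (hJmin (T ω))
  linarith

end Oracle

end DRQAgg

/-! ### The uniform-prior and general-prior bounds -/

theorem mainTheorem3 (U : ℝ) (hU : 0 ≤ U) :
    ∃ C : ℝ, 0 < C ∧
    -- population: covariates `W`, features `X = proj W`, treatment `D`, potential outcomes, outcome
    ∀ (Ω 𝒲 𝒳 : Type*) [MeasurableSpace Ω] [MeasurableSpace 𝒲] [MeasurableSpace 𝒳]
      (P : Measure Ω) [IsProbabilityMeasure P]
      (W : Ω → 𝒲) (proj : 𝒲 → 𝒳) (D Y₁ Y₀ Y : Ω → ℝ),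
      Measurable W → Measurable proj → Measurable D →
      Measurable Y₁ → Measurable Y₀ → Measurable Y →
      (∀ᵐ ω ∂P, D ω = 0 ∨ D ω = 1) →
      (∀ᵐ ω ∂P, Y ω = D ω * Y₁ ω + (1 - D ω) * Y₀ ω) →
      Integrable Y₁ P → Integrable Y₀ P →
      MemLp (DRQAgg.cate P (fun ω => proj (W ω)) Y₁ Y₀) 2 P →
      -- conditional exogeneity and overlap
      DRQAgg.CondIndepGiven P (DRQAgg.sigmaOf W) (fun ω => (Y₁ ω, Y₀ ω)) D →
      (∀ᵐ ω ∂P, 0 < DRQAgg.propensity P W D ω ∧ DRQAgg.propensity P W D ω < 1) →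
    -- `n` i.i.d. observations `Z i` of `(W, D, Y)`, and independent training data `T`
    ∀ (n M : ℕ), 1 ≤ n → 1 ≤ M →
    ∀ (Ω' 𝒯 : Type*) [MeasurableSpace Ω'] [MeasurableSpace 𝒯]
      (P' : Measure Ω') [IsProbabilityMeasure P']
      (Z : Fin n → Ω' → 𝒲 × ℝ × ℝ) (T : Ω' → 𝒯),
      iIndepFun Z P' →
      (∀ i, IdentDistrib (Z i) (fun ω => (W ω, D ω, Y ω)) P' P) →
      Measurable T → IndepFun T (fun ω i => Z i ω) P' →
    -- candidate models and nuisance estimates, fitted on the training data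
    ∀ (f : 𝒯 → Fin M → 𝒳 → ℝ) (h a : 𝒯 → ℝ → 𝒲 → ℝ),
      (∀ j, Measurable (fun p : 𝒯 × 𝒳 => f p.1 j p.2)) →
      Measurable (fun p : 𝒯 × ℝ × 𝒲 => h p.1 p.2.1 p.2.2) →
      Measurable (fun p : 𝒯 × ℝ × 𝒲 => a p.1 p.2.1 p.2.2) →
      (∀ᵐ t ∂(P'.map T), Integrable (DRQAgg.nuisanceProduct P W D Y (h t) (a t)) P) →
      (∀ᵐ t ∂(P'.map T), ∀ᵐ ω ∂P, |DRQAgg.drLabel (h t) (a t) (W ω, D ω, Y ω)| ≤ U) →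
      (∀ᵐ t ∂(P'.map T), ∀ j, ∀ᵐ ω ∂P, |f t j (proj (W ω))| ≤ U) →
    ∀ δ : ℝ, 0 < δ → δ < 1 →
      -- uniform prior, arbitrary `β`
      (∀ (β : ℝ) (θhat : Ω' → Fin M → ℝ),
        (∀ᵐ ω ∂P', DRQAgg.IsQAggregate (1 / 2) β (fun _ => 1 / (M : ℝ)) proj
          (h (T ω)) (a (T ω)) (f (T ω)) (fun i => Z i ω) (θhat ω)) →
        P' {ω | ¬ (DRQAgg.sqDist P (fun ω' => proj (W ω'))
                (DRQAgg.ensemble (f (T ω)) (θhat ω))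
                (DRQAgg.cate P (fun ω' => proj (W ω')) Y₁ Y₀) ≤
              (⨅ j, DRQAgg.sqDist P (fun ω' => proj (W ω')) (f (T ω) j)
                (DRQAgg.cate P (fun ω' => proj (W ω')) Y₁ Y₀)) +
              C * (Real.log ((M : ℝ) / δ) / (n : ℝ) +
                DRQAgg.nuisanceError P (fun ω' => proj (W ω')) W D Y
                  (h (T ω)) (a (T ω)) ^ 2))} ≤ ENNReal.ofReal δ) ∧
      -- general prior
      (∀ (prior : Fin M → ℝ), (∀ j, 0 < prior j) → ∑ j, prior j = 1 →
        ∀ (β : ℝ), max (112 * U ^ 2) (56 * U ^ 3) ≤ β →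
        ∀ (θhat : Ω' → Fin M → ℝ),
        (∀ᵐ ω ∂P', DRQAgg.IsQAggregate (1 / 2) β prior proj
          (h (T ω)) (a (T ω)) (f (T ω)) (fun i => Z i ω) (θhat ω)) →
        P' {ω | ¬ (DRQAgg.sqDist P (fun ω' => proj (W ω'))
                (DRQAgg.ensemble (f (T ω)) (θhat ω))
                (DRQAgg.cate P (fun ω' => proj (W ω')) Y₁ Y₀) ≤
              (⨅ j, (DRQAgg.sqDist P (fun ω' => proj (W ω')) (f (T ω) j)
                (DRQAgg.cate P (fun ω' => proj (W ω')) Y₁ Y₀) +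
                β / (n : ℝ) * Real.log (1 / prior j))) +
              C * (Real.log (1 / δ) / (n : ℝ) +
                DRQAgg.nuisanceError P (fun ω' => proj (W ω')) W D Y
                  (h (T ω)) (a (T ω)) ^ 2))} ≤ ENNReal.ofReal δ) := by
  -- `14` covers the nuisance error; `112 U²` covers `log M` for the uniform prior and dominates the
  -- `56 U²` in front of `log (1/δ)`.
  refine ⟨112 * U ^ 2 + 14, by positivity, ?_⟩
  intro Ω 𝒲 𝒳 _ _ _ P _ W proj D Y₁ Y₀ Y hW hproj hD hY₁m hY₀m hYm hD01 hY hY₁ hY₀ hτ hci hp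
    n M hn hM Ω' 𝒯 _ _ P' _ Z T hZ hid hT hTZ f h a hf hh ha hq hψb hfb δ hδ hδ1
  have hne : Nonempty (Fin M) := ⟨⟨0, hM⟩⟩
  have hn0 : (0 : ℝ) < n := by exact_mod_cast hn
  have hM0 : (0 : ℝ) < M := by exact_mod_cast hM
  have hM1 : (1 : ℝ) ≤ M := by exact_mod_cast hM
  have hL : 0 ≤ Real.log (1 / δ) / n :=
    div_nonneg (Real.log_nonneg ((one_le_div hδ).2 hδ1.le)) hn0.le
  have hLM : 0 ≤ Real.log M / n := div_nonneg (Real.log_nonneg hM1) hn0.le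
  have hU2 := sq_nonneg U
  constructor
  · intro β θhat hθ
    -- Under a constant prior the penalty is constant on the simplex, so the same `θhat` is optimal
    -- for `β = 112 U²`, the smallest value that the oracle inequality admits.
    have hmain := DRQAgg.measure_oracle_inequality_le hU hW hproj hD hY₁m hY₀m hYm hD01 hY hY₁ hY₀
      hτ hci hp hn hM hZ hid hT hTZ hf hh ha hq hψb hfb hδ hδ1
      (prior := fun _ => 1 / (M : ℝ)) (fun _ => one_div_pos.2 hM0) (by simp [hM0.ne'])
      (β := 112 * U ^ 2) le_rfl (hθ.mono fun ω g => g.of_const_prior _)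
    refine le_trans (measure_mono ?_) hmain
    intro ω hω
    rw [Set.mem_ofPred_eq] at hω ⊢
    refine fun hle => hω (hle.trans ?_)
    obtain ⟨j, hj⟩ := exists_eq_ciInf_of_finite
      (f := fun j => DRQAgg.sqDist P (fun ω' => proj (W ω')) (f (T ω) j)
        (DRQAgg.cate P (fun ω' => proj (W ω')) Y₁ Y₀))
    have hinf := ciInf_le (Finite.bddBelow_range fun j =>
      DRQAgg.sqDist P (fun ω' => proj (W ω')) (f (T ω) j)
        (DRQAgg.cate P (fun ω' => proj (W ω')) Y₁ Y₀) +
        112 * U ^ 2 / n * Real.log (1 / (1 / (M : ℝ)))) j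
    rw [← hj]
    have he := sq_nonneg
      (DRQAgg.nuisanceError P (fun ω' => proj (W ω')) W D Y (h (T ω)) (a (T ω)))
    set E := DRQAgg.nuisanceError P (fun ω' => proj (W ω')) W D Y (h (T ω)) (a (T ω)) ^ 2
    have hlog : Real.log ((M : ℝ) / δ) / n = Real.log M / n + Real.log (1 / δ) / n := by
      rw [← add_div, ← Real.log_mul hM0.ne' (one_div_pos.2 hδ).ne', mul_one_div]
    rw [hlog]
    rw [one_div_one_div] at hinf ⊢
    have e1 : 112 * U ^ 2 / n * Real.log M = 112 * U ^ 2 * (Real.log M / n) := by ring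
    have e2 : 56 * U ^ 2 / n * Real.log (1 / δ) = 56 * U ^ 2 * (Real.log (1 / δ) / n) := by ring
    rw [e1] at hinf ⊢
    rw [e2]
    have p1 := mul_nonneg hU2 hL
    have p2 := mul_nonneg hU2 he
    linarith
  · intro prior hπ hπ1 β hβ θhat hθ
    have hmain := DRQAgg.measure_oracle_inequality_le hU hW hproj hD hY₁m hY₀m hYm hD01 hY hY₁ hY₀
      hτ hci hp hn hM hZ hid hT hTZ hf hh ha hq hψb hfb hδ hδ1 hπ hπ1
      ((le_max_left _ _).trans hβ) hθ
    refine le_trans (measure_mono ?_) hmain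
    intro ω hω
    rw [Set.mem_ofPred_eq] at hω ⊢
    refine fun hle => hω (hle.trans ?_)
    refine add_le_add le_rfl ?_
    have he := sq_nonneg
      (DRQAgg.nuisanceError P (fun ω' => proj (W ω')) W D Y (h (T ω)) (a (T ω)))
    set E := DRQAgg.nuisanceError P (fun ω' => proj (W ω')) W D Y (h (T ω)) (a (T ω)) ^ 2
    have e2 : 56 * U ^ 2 / n * Real.log (1 / δ) = 56 * U ^ 2 * (Real.log (1 / δ) / n) := by ring
    rw [e2]
    have p1 := mul_nonneg hU2 hL
    have p2 := mul_nonneg hU2 he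
    linarith
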